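/- A frequency is a strictly increasing sequence $\lambda=(\lambda_n)$ of non-negative real numbers tending to $\infty$. Let $(G,\beta)$ be a $\lambda$-Dirichlet group: $G$ is a compact (Hausdorff) abelian group with normalized Haar measure, $\beta\colon\mathbb{R}\to G$ is a continuous homomorphism with dense range, and for every $n$ there is a (necessarily unique) continuous character $h_{\lambda_n}$ of $G$ with $h_{\lambda_n}(\beta(t))=e^{-i\lambda_n t}$ for all $t\in\mathbb{R}$. For $1\le p\le\infty$ let $H_p^\lambda(G)$ be the space of all $f\in L_p(G)$ whose Fourier coefficients $\widehat f(\gamma)=\int_G f\,\overline{\gamma}$ vanish at every character $\gamma\notin\{h_{\lambda_n}\}$, and let $\mathcal{H}_p(\lambda)$ be the space of all formal Dirichlet series $D=\sum_n a_n e^{-\lambda_n s}$ for which there is some $f\in H_p^\lambda(G)$ with $a_n=\widehat f(h_{\lambda_n})$ for all $n$; this $f$ is unique, and $\|D\|_p:=\|f\|_p$. Theorem. Let $1<p<\infty$, let $\lambda$ be a frequency and $(G,\beta)$ any $\lambda$-Dirichlet group. Then the monomials $(e^{-\lambda_n s})_n$ form a Schauder basis of $\mathcal{H}_p(\lambda)$,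 whose coordinate functionals are the Dirichlet coefficients: every $D=\sum a_n e^{-\lambda_n s}\in\mathcal{H}_p(\lambda)$ is the limit in $\|\cdot\|_p$ of its partial sums $\sum_{n\le N}a_n e^{-\lambda_n s}$. Moreover, the partial-sum projections $\pi_p^N\colon\mathcal{H}_p(\lambda)\to\mathcal{H}_p(\lambda)$, $\sum a_n e^{-\lambda_n s}\mapsto\sum_{n\le N}a_n e^{-\lambda_n s}$, are uniformly bounded: $\sup_N\|\pi_p^N\|<\infty$. -/

import Mathlib

open MeasureTheory Filter Topology
open scoped ENNReal ComplexConjugate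

namespace GeneralDirichlet

/-- A frequency: a non-negative strictly increasing sequence of real numbers tending to `∞`. -/
structure IsFrequency (lam : ℕ → ℝ) : Prop where
  nonneg : ∀ n, 0 ≤ lam n
  strictMono : StrictMono lam
  tendsto : Tendsto lam atTop atTop

/-- A formal `λ`-Dirichlet series `∑ a n * exp (-λ n * s)`, given by its Dirichlet coefficients. -/
abbrev DirichletSeries (_lam : ℕ → ℝ) : Type := ℕ → ℂ

/-- The monomial `exp (-λ n * s)`, as a formal `λ`-Dirichlet series. -/
def monomial (lam : ℕ → ℝ) (n : ℕ) : DirichletSeries lam := Pi.single n 1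

section Groups

variable {G : Type*} [CommGroup G] [TopologicalSpace G]

/-- The compact abelian group `G` together with the continuous homomorphism `β : ℝ → G` is a
`λ`-Dirichlet group: `β` has dense range, and every character `t ↦ exp (-i λ n t)` of `ℝ` extends
along `β` to a (continuous) character of `G`. -/
structure IsLambdaDirichletGroup (lam : ℕ → ℝ) (β : Multiplicative ℝ →ₜ* G) : Prop where
  denseRange : DenseRange β
  exists_char : ∀ n, ∃ h : PontryaginDual G,
    ∀ t : ℝ, h (β (Multiplicative.ofAdd t)) = Circle.exp (-(lam n * t))

/-- The character `h_{λ n}` of `G` that extends `t ↦ exp (-i λ n t)`. -/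
noncomputable def IsLambdaDirichletGroup.char {lam : ℕ → ℝ} {β : Multiplicative ℝ →ₜ* G}
    (hβ : IsLambdaDirichletGroup lam β) (n : ℕ) : PontryaginDual G :=
  (hβ.exists_char n).choose

theorem IsLambdaDirichletGroup.char_spec {lam : ℕ → ℝ} {β : Multiplicative ℝ →ₜ* G}
    (hβ : IsLambdaDirichletGroup lam β) (n : ℕ) (t : ℝ) :
    hβ.char n (β (Multiplicative.ofAdd t)) = Circle.exp (-(lam n * t)) :=
  (hβ.exists_char n).choose_spec t

/-- `h_{λ n}` is the only character of `G` that extends `t ↦ exp (-i λ n t)`. -/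
theorem IsLambdaDirichletGroup.char_unique {lam : ℕ → ℝ} {β : Multiplicative ℝ →ₜ* G}
    (hβ : IsLambdaDirichletGroup lam β) (n : ℕ) (h : PontryaginDual G)
    (hh : ∀ t : ℝ, h (β (Multiplicative.ofAdd t)) = Circle.exp (-(lam n * t))) :
    h = hβ.char n := by
  have key : (h : G → Circle) = hβ.char n :=
    hβ.denseRange.equalizer (map_continuous h) (map_continuous (hβ.char n)) <| by
      funext t
      exact (hh t.toAdd).trans (hβ.char_spec n t.toAdd).symm
  exact PontryaginDual.ext fun a => congrFun key a

variable [IsTopologicalGroup G] [CompactSpace G] [MeasurableSpace G] [BorelSpace G]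

/-- The normalized Haar measure of the compact group `G`. -/
noncomputable def haarProb (G : Type*) [CommGroup G] [TopologicalSpace G] [IsTopologicalGroup G]
    [CompactSpace G] [MeasurableSpace G] [BorelSpace G] : Measure G :=
  Measure.haarMeasure (⊤ : TopologicalSpace.PositiveCompacts G)

instance : IsProbabilityMeasure (haarProb G) :=
  ⟨by simpa [haarProb] using
    Measure.haarMeasure_self (K₀ := (⊤ : TopologicalSpace.PositiveCompacts G))⟩

variable {p : ℝ≥0∞} [Fact (1 ≤ p)]

theorem integrable_mul_conj (f : Lp ℂ p (haarProb G)) (γ : PontryaginDual G) :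
    Integrable (fun ω => f ω * conj (γ ω : ℂ)) (haarProb G) := by
  have hf : Integrable f (haarProb G) := (Lp.memLp f).integrable Fact.out
  refine hf.mul_bdd (c := 1) ?_ (ae_of_all _ fun ω => by simp [Circle.norm_coe])
  have hc : Continuous fun ω : G => conj (γ ω : ℂ) :=
    Complex.continuous_conj.comp (continuous_subtype_val.comp (map_continuous γ))
  exact hc.measurable.aestronglyMeasurable

variable (p) in
/-- The Fourier coefficient `f ↦ ∫ f(ω) conj(γ(ω)) dω` of functions in `L_p(G)` at the character
`γ`. -/
noncomputable def charCoeff (γ : PontryaginDual G) : Lp ℂ p (haarProb G) →ₗ[ℂ] ℂ where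
  toFun f := ∫ ω, f ω * conj (γ ω : ℂ) ∂(haarProb G)
  map_add' f g := by
    rw [← integral_add (integrable_mul_conj f γ) (integrable_mul_conj g γ)]
    refine integral_congr_ae ?_
    filter_upwards [Lp.coeFn_add f g] with ω h
    rw [h, Pi.add_apply, add_mul]
  map_smul' c f := by
    rw [RingHom.id_apply, smul_eq_mul, ← integral_const_mul]
    refine integral_congr_ae ?_
    filter_upwards [Lp.coeFn_smul c f] with ω h
    rw [h, Pi.smul_apply, smul_eq_mul, mul_assoc]

theorem continuous_charCoeff (γ : PontryaginDual G) :
    Continuous (charCoeff p γ : Lp ℂ p (haarProb G) → ℂ) := by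
  refine AddMonoidHomClass.continuous_of_bound (charCoeff p γ) 1 fun f => ?_
  have hf : Integrable f (haarProb G) := (Lp.memLp f).integrable Fact.out
  have h1 : ‖charCoeff p γ f‖ ≤ ∫ ω, ‖f ω‖ ∂(haarProb G) := by
    refine (norm_integral_le_integral_norm _).trans_eq ?_
    simp [Circle.norm_coe]
  have h2 : ∫ ω, ‖f ω‖ ∂(haarProb G) = (eLpNorm f 1 (haarProb G)).toReal := by
    rw [integral_norm_eq_lintegral_enorm hf.aestronglyMeasurable, eLpNorm_one_eq_lintegral_enorm]
  rw [one_mul, Lp.norm_def]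
  refine h1.trans (h2.trans_le ?_)
  exact ENNReal.toReal_mono (Lp.eLpNorm_ne_top f)
    (eLpNorm_le_eLpNorm_of_exponent_le Fact.out (Lp.aestronglyMeasurable f))

variable {lam : ℕ → ℝ} {β : Multiplicative ℝ →ₜ* G}

variable (p) in
/-- The Hardy space `H_p^λ(G)`: all `f ∈ L_p(G)` whose Fourier transform vanishes at every
character of `G` that is not one of the `h_{λ n}`. -/
noncomputable def hardyGroup (hβ : IsLambdaDirichletGroup lam β) :
    Submodule ℂ (Lp ℂ p (haarProb G)) where
  carrier := {f | ∀ γ : PontryaginDual G, charCoeff p γ f ≠ 0 → ∃ n, γ = hβ.char n}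
  zero_mem' γ h := absurd (map_zero _) h
  add_mem' {f g} hf hg γ h := by
    by_contra hγ
    have h1 : charCoeff p γ f = 0 := by_contra fun h' => hγ (hf γ h')
    have h2 : charCoeff p γ g = 0 := by_contra fun h' => hγ (hg γ h')
    exact h (by rw [map_add, h1, h2, add_zero])
  smul_mem' c f hf γ h := hf γ fun h' => h (by rw [map_smul, h', smul_zero])

theorem isClosed_hardyGroup (hβ : IsLambdaDirichletGroup lam β) :
    IsClosed (hardyGroup p hβ : Set (Lp ℂ p (haarProb G))) := by
  have h : (hardyGroup p hβ : Set (Lp ℂ p (haarProb G))) =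
      ⋂ γ : PontryaginDual G, ⋂ _ : ¬ ∃ n, γ = hβ.char n, {f | charCoeff p γ f = 0} := by
    ext f
    simp only [Set.mem_iInter]
    exact forall_congr' fun γ => not_imp_comm
  rw [h]
  exact isClosed_iInter fun γ => isClosed_iInter fun _ =>
    isClosed_eq (continuous_charCoeff γ) continuous_const

variable (p) in
/-- The Bohr map, which sends `f ∈ H_p^λ(G)` to the formal Dirichlet series
`∑ f̂(h_{λ n}) exp (-λ n s)`. -/
noncomputable def bohrMap (hβ : IsLambdaDirichletGroup lam β) :
    hardyGroup p hβ →ₗ[ℂ] DirichletSeries lam :=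
  LinearMap.pi fun n => (charCoeff p (hβ.char n)).comp (hardyGroup p hβ).subtype

variable (p) in
/-- The Hardy space `ℋ_p(λ)`: all `λ`-Dirichlet series `∑ a n * exp (-λ n * s)` for which there is
some `f ∈ H_p^λ(G)` such that `a n = f̂(h_{λ n})` for all `n`. -/
def HardySpace (hβ : IsLambdaDirichletGroup lam β) : Type :=
  LinearMap.range (bohrMap p hβ)

namespace HardySpace

variable (hβ : IsLambdaDirichletGroup lam β)

/-- The Dirichlet series underlying an element of `ℋ_p(λ)`. -/
def toSeries {hβ : IsLambdaDirichletGroup lam β} (D : HardySpace p hβ) : DirichletSeries lam :=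
  D.1

noncomputable instance : AddCommGroup (HardySpace p hβ) :=
  inferInstanceAs (AddCommGroup (LinearMap.range (bohrMap p hβ)))

noncomputable instance : Module ℂ (HardySpace p hβ) :=
  inferInstanceAs (Module ℂ (LinearMap.range (bohrMap p hβ)))

variable (p) in
/-- The Bohr map as a linear map from `H_p^λ(G)` onto `ℋ_p(λ)`. -/
noncomputable def bohr : hardyGroup p hβ →ₗ[ℂ] HardySpace p hβ :=
  (bohrMap p hβ).rangeRestrict

theorem toSeries_bohr (f : hardyGroup p hβ) (n : ℕ) :
    toSeries (bohr p hβ f) n = charCoeff p (hβ.char n) (f : Lp ℂ p (haarProb G)) := rfl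

instance isClosed_ker : IsClosed ((LinearMap.ker (bohrMap p hβ) :
    Submodule ℂ (hardyGroup p hβ)) : Set (hardyGroup p hβ)) := by
  have h : ((LinearMap.ker (bohrMap p hβ) : Submodule ℂ (hardyGroup p hβ)) :
      Set (hardyGroup p hβ)) = ⋂ n : ℕ,
        {f : hardyGroup p hβ | charCoeff p (hβ.char n) (f : Lp ℂ p (haarProb G)) = 0} := by
    ext f
    simp only [SetLike.mem_coe, LinearMap.mem_ker, Set.mem_iInter]
    exact funext_iff
  rw [h]
  exact isClosed_iInter fun n =>
    isClosed_eq ((continuous_charCoeff _).comp continuous_subtype_val) continuous_const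

variable (p) in
/-- The isomorphism of `ℋ_p(λ)` with `H_p^λ(G)` modulo the kernel of the Bohr map (this kernel is
in fact zero, since a function in `L_p(G)` is determined by its Fourier coefficients). -/
noncomputable def equivQuotient :
    HardySpace p hβ ≃ₗ[ℂ] (hardyGroup p hβ ⧸ LinearMap.ker (bohrMap p hβ)) :=
  (bohrMap p hβ).quotKerEquivRange.symm

/-- The norm on `ℋ_p(λ)` that is transported from `H_p^λ(G)` by the Bohr map: `‖D‖` is the norm
`‖f‖_p` of the function `f ∈ H_p^λ(G)` with `D = ∑ f̂(h_{λ n}) exp (-λ n s)`, formally the infimum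
of `‖f‖_p` over all such `f`. -/
noncomputable instance : NormedAddCommGroup (HardySpace p hβ) :=
  NormedAddCommGroup.induced (HardySpace p hβ)
    (hardyGroup p hβ ⧸ LinearMap.ker (bohrMap p hβ)) (equivQuotient p hβ)
    (equivQuotient p hβ).injective

noncomputable instance : NormedSpace ℂ (HardySpace p hβ) :=
  NormedSpace.induced ℂ (HardySpace p hβ)
    (hardyGroup p hβ ⧸ LinearMap.ker (bohrMap p hβ)) (equivQuotient p hβ)

theorem norm_def (D : HardySpace p hβ) : ‖D‖ = ‖equivQuotient p hβ D‖ := rfl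

theorem equivQuotient_bohr (f : hardyGroup p hβ) :
    equivQuotient p hβ (bohr p hβ f) = Submodule.Quotient.mk f :=
  (bohrMap p hβ).quotKerEquivRange.symm_apply_eq.2 rfl

/-- The norm on `ℋ_p(λ)` in terms of the Bohr map. -/
theorem norm_eq_sInf (D : HardySpace p hβ) :
    ‖D‖ = sInf (norm '' {f : hardyGroup p hβ | bohr p hβ f = D}) := by
  obtain ⟨f, rfl⟩ := (bohrMap p hβ).surjective_rangeRestrict D
  change ‖bohr p hβ f‖ = sInf (norm '' {g | bohr p hβ g = bohr p hβ f})
  refine (csInf_eq_of_forall_ge_of_forall_gt_exists_lt ?_ ?_ ?_).symm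
  · exact ⟨‖f‖, f, rfl, rfl⟩
  · rintro _ ⟨g, hg, rfl⟩
    rw [← (show bohr p hβ g = bohr p hβ f from hg), norm_def, equivQuotient_bohr]
    exact Submodule.Quotient.norm_mk_le _ g
  · intro w hw
    obtain ⟨g, hg, hgw⟩ := Submodule.Quotient.norm_mk_lt
      (equivQuotient p hβ (bohr p hβ f)) (sub_pos.2 hw)
    refine ⟨‖g‖, ⟨g, ?_, rfl⟩, ?_⟩
    · apply (equivQuotient p hβ).injective
      rw [equivQuotient_bohr, hg]
    · rw [← norm_def] at hgw
      linarith

instance : CompleteSpace (HardySpace p hβ) := by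
  have : CompleteSpace (hardyGroup p hβ) := (isClosed_hardyGroup hβ).completeSpace_coe
  have hiso : Isometry (equivQuotient p hβ) :=
    AddMonoidHomClass.isometry_of_norm (equivQuotient p hβ) fun D => (norm_def hβ D).symm
  exact (completeSpace_congr (e := (equivQuotient p hβ).toEquiv) hiso.isUniformEmbedding).2
    inferInstance

end HardySpace

end Groups

end GeneralDirichlet

open GeneralDirichlet

set_option linter.unusedSectionVars false

/-! Along `β` the character `hβ.char n` oscillates with real frequency `λ n`. Multiplying by the
conjugate of `hβ.char N` shifts all frequencies by `-λ N`, so the terms with `n < N` become exactly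
those of negative frequency. Truncation is thus a Riesz projection. Two facts suffice: on
trigonometric polynomials the projection to negative frequencies is bounded in `L_p`, with a
constant independent of `N` (`exists_norm_negative_part_le`), and polynomials in the `hβ.char n` are
dense in the Hardy space (`mem_closure_span_spectrum`).

For the bound, let `F` be a polynomial with positive frequencies. Damping each term by `e^(-μ σ)`
extends `F` to a function holomorphic in `σ + it` along the flow `x ↦ β(t) x`, with limit `0` as `σ
→ ∞`. For subharmonic `Φ` the mean of `Φ(F_σ)` is convex in `σ`, since invariance of Haar measure
removes the `t`-derivatives; it tends to `Φ 0`, so it is at least `Φ 0` at `σ = 0`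
(`IsSubharmonicC2.le_integral`). Suitable regularized `Φ` yield `‖F‖_p ≤ K ‖Re F‖_p`. A general
polynomial reduces to this one by conjugating its negative-frequency part.

For density, averages of translates against a continuous kernel are compact operators that commute
with translations, and on `L_2` they are self-adjoint for symmetric kernels. A nonzero function in
`L_2` with no Fourier coefficients would give such an operator a finite-dimensional
translation-invariant eigenspace, hence a common eigenvector of all translations, which is a
multiple of a character: a contradiction. So characters separate points, Stone–Weierstrass applies,
and averaging `f` against trigonometric polynomials approximates `f` within its own spectrum. -/

namespace GeneralDirichlet

/-! ### Translations and averages on `L_p(G)` -/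

section Translation

variable {G : Type*} [CommGroup G] [TopologicalSpace G] [IsTopologicalGroup G]
    [CompactSpace G] [MeasurableSpace G] [BorelSpace G]

instance : (haarProb G).IsHaarMeasure :=
  inferInstanceAs (Measure.haarMeasure (⊤ : TopologicalSpace.PositiveCompacts G)).IsHaarMeasure

instance : (haarProb G).Regular :=
  inferInstanceAs (Measure.haarMeasure (⊤ : TopologicalSpace.PositiveCompacts G)).Regular

theorem _root_.Continuous.integrable_haarProb {E : Type*} [NormedAddCommGroup E] {f : G → E}
    (hf : Continuous f) : Integrable f (haarProb G) :=
  hf.integrable_of_hasCompactSupport (HasCompactSupport.of_compactSpace f)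

/-- A character of `G` as a continuous complex-valued function. -/
noncomputable def charFun (γ : PontryaginDual G) : C(G, ℂ) where
  toFun x := (γ x : ℂ)
  continuous_toFun := continuous_subtype_val.comp (map_continuous γ)

@[simp]
theorem charFun_apply (γ : PontryaginDual G) (x : G) : charFun γ x = (γ x : ℂ) := rfl

variable {p : ℝ≥0∞} [Fact (1 ≤ p)]

variable (p) in
/-- The class in `L_p(G)` of a continuous function on `G`. -/
noncomputable abbrev classLp : C(G, ℂ) →L[ℂ] Lp ℂ p (haarProb G) :=
  ContinuousMap.toLp p (haarProb G) ℂ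

theorem norm_classLp_le (f : C(G, ℂ)) : ‖classLp p f‖ ≤ ‖f‖ := by
  have h : ‖classLp p f‖ ≤ _ := Lp.norm_le_of_ae_bound (norm_nonneg f) (by
    filter_upwards [ContinuousMap.coeFn_toLp (p := p) (𝕜 := ℂ) (haarProb G) f] with x hx
    rw [hx]
    exact f.norm_coe_le_norm x)
  have h1 : measureUnivNNReal (haarProb G) = 1 := by
    ext
    simp [measureUnivNNReal]
  simpa [h1] using h

theorem charCoeff_classLp (γ : PontryaginDual G) (f : C(G, ℂ)) :
    charCoeff p γ (classLp p f) = ∫ x, f x * conj (γ x : ℂ) ∂(haarProb G) := by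
  refine integral_congr_ae ?_
  filter_upwards [ContinuousMap.coeFn_toLp (p := p) (𝕜 := ℂ) (haarProb G) f] with x hx
  rw [hx]

/-- The translation `f ↦ f (g * ·)` on `L_p(G)`. -/
noncomputable def translate (g : G) : Lp ℂ p (haarProb G) →ₗᵢ[ℂ] Lp ℂ p (haarProb G) where
  toFun f := DomMulAct.mk g • f
  map_add' := smul_add _
  map_smul' c f := smul_comm _ c f
  norm_map' f := DomMulAct.norm_smul_Lp _ f

theorem translate_ae_eq (g : G) (f : Lp ℂ p (haarProb G)) :
    translate g f =ᵐ[haarProb G] fun x => f (g * x) :=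
  DomMulAct.smul_Lp_ae_eq (DomMulAct.mk g) f

theorem translate_translate (g h : G) (f : Lp ℂ p (haarProb G)) :
    translate g (translate h f) = translate (h * g) f :=
  smul_smul (DomMulAct.mk g) (DomMulAct.mk h) f

theorem translate_one (f : Lp ℂ p (haarProb G)) : translate 1 f = f :=
  one_smul _ f

theorem translate_classLp (g : G) (f : C(G, ℂ)) :
    translate g (classLp p f) = classLp p (f.comp (ContinuousMap.mk (g * ·))) := rfl

theorem continuous_translate (hp : p ≠ ∞) (f : Lp ℂ p (haarProb G)) :
    Continuous fun g : G => translate g f := by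
  have : Fact (p ≠ ∞) := ⟨hp⟩
  exact (continuous_id.smul continuous_const : Continuous fun c : Gᵈᵐᵃ => c • f).comp
    DomMulAct.continuous_mk

theorem charCoeff_translate (γ : PontryaginDual G) (g : G) (f : Lp ℂ p (haarProb G)) :
    charCoeff p γ (translate g f) = (γ g : ℂ) * charCoeff p γ f := by
  have h1 : charCoeff p γ (translate g f) =
      ∫ x, (γ g : ℂ) * (f (g * x) * conj (γ (g * x) : ℂ)) ∂(haarProb G) := by
    refine integral_congr_ae ?_
    filter_upwards [translate_ae_eq g f] with x hx
    have : (γ g : ℂ) * conj (γ g : ℂ) = 1 := by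
      rw [Complex.mul_conj, Circle.normSq_coe]; simp
    rw [hx, map_mul, Circle.coe_mul, map_mul]
    linear_combination -(f (g * x) * conj (γ x : ℂ)) * this
  rw [h1, integral_const_mul,
    integral_mul_left_eq_self (fun x => f x * conj (γ x : ℂ)) g]
  rfl

theorem continuous_smul_translate (hp : p ≠ ∞) (K : C(G, ℂ)) (f : Lp ℂ p (haarProb G)) :
    Continuous fun y => K y • translate y f :=
  (map_continuous K).smul (continuous_translate hp f)

/-- The average `∫ K(y) f(y ·) dy` of the translates of `f ∈ L_p(G)` with a continuous weight. -/
noncomputable def average (K : C(G, ℂ)) (f : Lp ℂ p (haarProb G)) : Lp ℂ p (haarProb G) :=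
  ∫ y, K y • translate y f ∂(haarProb G)

theorem norm_integral_haarProb_le {E : Type*} [NormedAddCommGroup E] [NormedSpace ℝ E] {C : ℝ}
    {f : G → E} (hf : ∀ x, ‖f x‖ ≤ C) : ‖∫ x, f x ∂(haarProb G)‖ ≤ C := by
  simpa using norm_integral_le_of_norm_le_const (μ := haarProb G) (ae_of_all _ hf)

theorem norm_average_le (K : C(G, ℂ)) (f : Lp ℂ p (haarProb G)) :
    ‖average K f‖ ≤ ‖K‖ * ‖f‖ := by
  refine norm_integral_haarProb_le fun y => ?_
  rw [norm_smul, LinearIsometry.norm_map]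
  gcongr
  exact K.norm_coe_le_norm y

variable (p) in
/-- `average K` as a continuous linear map. -/
noncomputable def averageCLM (hp : p ≠ ∞) (K : C(G, ℂ)) :
    Lp ℂ p (haarProb G) →L[ℂ] Lp ℂ p (haarProb G) :=
  LinearMap.mkContinuous
    { toFun := average K
      map_add' := fun f g => by
        simp only [average, map_add, smul_add]
        exact integral_add (continuous_smul_translate hp K f).integrable_haarProb
          (continuous_smul_translate hp K g).integrable_haarProb
      map_smul' := fun c f => by
        simp only [average, map_smul, RingHom.id_apply]
        rw [← integral_smul]
        simp only [smul_comm c] } ‖K‖ (norm_average_le K)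

@[simp]
theorem averageCLM_apply (hp : p ≠ ∞) (K : C(G, ℂ)) (f : Lp ℂ p (haarProb G)) :
    averageCLM p hp K f = average K f := rfl

theorem average_add (hp : p ≠ ∞) (K L : C(G, ℂ)) (f : Lp ℂ p (haarProb G)) :
    average (K + L) f = average K f + average L f := by
  simp only [average, ContinuousMap.add_apply, add_smul]
  exact integral_add (continuous_smul_translate hp K f).integrable_haarProb
    (continuous_smul_translate hp L f).integrable_haarProb

theorem average_smul (c : ℂ) (K : C(G, ℂ)) (f : Lp ℂ p (haarProb G)) :
    average (c • K) f = c • average K f := by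
  simp only [average, ContinuousMap.smul_apply, smul_eq_mul, mul_smul, integral_smul]

theorem average_sub (hp : p ≠ ∞) (K L : C(G, ℂ)) (f : Lp ℂ p (haarProb G)) :
    average (K - L) f = average K f - average L f := by
  rw [sub_eq_add_neg, ← neg_one_smul ℂ L, average_add hp, average_smul, neg_one_smul,
    sub_eq_add_neg]

theorem translate_average (hp : p ≠ ∞) (K : C(G, ℂ)) (g : G) (f : Lp ℂ p (haarProb G)) :
    translate g (average K f) = average K (translate g f) := by
  have h := ((translate (p := p) g).toContinuousLinearMap).integral_comp_comm
    (continuous_smul_translate hp K f).integrable_haarProb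
  refine h.symm.trans (integral_congr_ae (ae_of_all _ fun y => ?_))
  simp [translate_translate, mul_comm]

theorem charCoeff_average (hp : p ≠ ∞) (γ : PontryaginDual G) (K : C(G, ℂ))
    (f : Lp ℂ p (haarProb G)) :
    charCoeff p γ (average K f) = (∫ y, K y * (γ y : ℂ) ∂(haarProb G)) * charCoeff p γ f := by
  let ℓ : Lp ℂ p (haarProb G) →L[ℂ] ℂ := ⟨charCoeff p γ, continuous_charCoeff γ⟩
  have h := ℓ.integral_comp_comm (continuous_smul_translate hp K f).integrable_haarProb
  refine h.symm.trans ?_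
  rw [← integral_mul_const]
  refine integral_congr_ae (ae_of_all _ fun y => ?_)
  change charCoeff p γ (K y • translate y f) = _
  rw [map_smul, charCoeff_translate, smul_eq_mul]
  exact (mul_assoc _ _ _).symm

theorem continuous_translate_continuousMap (f : C(G, ℂ)) :
    Continuous fun y : G => f.comp (ContinuousMap.mk (y * ·)) := by
  let m : C(G × G, ℂ) := f.comp ⟨fun q : G × G => q.1 * q.2, continuous_mul⟩
  exact m.curry.continuous

/-- For continuous `f` the integral already converges in `C(G)`, where it can be evaluated
pointwise; identities for `average` are checked there and extended by density. -/
theorem average_classLp (K f : C(G, ℂ)) :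
    average K (classLp p f) =
      classLp p (∫ y, K y • f.comp (ContinuousMap.mk (y * ·)) ∂(haarProb G)) := by
  have hc : Continuous fun y : G => K y • f.comp (ContinuousMap.mk (y * ·)) :=
    (map_continuous K).smul (continuous_translate_continuousMap f)
  refine Eq.trans ?_ ((classLp p).integral_comp_comm hc.integrable_haarProb)
  refine integral_congr_ae (ae_of_all _ fun y => ?_)
  change _ = classLp p (K y • f.comp (ContinuousMap.mk (y * ·)))
  rw [map_smul, ← translate_classLp]

theorem integral_translate_apply (K f : C(G, ℂ)) (x : G) :
    (∫ y, K y • f.comp (ContinuousMap.mk (y * ·)) ∂(haarProb G)) x =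
      ∫ y, K (y * x⁻¹) * f y ∂(haarProb G) := by
  have hc : Continuous fun y : G => K y • f.comp (ContinuousMap.mk (y * ·)) :=
    (map_continuous K).smul (continuous_translate_continuousMap f)
  rw [ContinuousMap.integral_apply hc.integrable_haarProb x,
    ← integral_mul_right_eq_self (fun y => K (y * x⁻¹) * f y) x]
  simp

theorem denseRange_classLp (hp : p ≠ ∞) : DenseRange (classLp (G := G) p) := 
  ContinuousMap.toLp_denseRange ℂ (haarProb G) ℂ hp

/-- Averaging against a conjugate character is the projection to that character, so averages against
trigonometric polynomials are trigonometric polynomials with no new frequencies. -/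
theorem average_conj_char (hp : p ≠ ∞) (γ : PontryaginDual G) (f : Lp ℂ p (haarProb G)) :
    average (star (charFun γ)) f = charCoeff p γ f • classLp p (charFun γ) := by
  refine congrFun ((denseRange_classLp hp).equalizer (averageCLM p hp _).continuous
    ((continuous_charCoeff γ).smul continuous_const) (funext fun f => ?_)) f
  change average _ (classLp p f) = charCoeff p γ (classLp p f) • classLp p (charFun γ)
  rw [average_classLp, ← map_smul]
  congr 1
  ext x
  rw [integral_translate_apply, charCoeff_classLp, ContinuousMap.smul_apply, smul_eq_mul,
    ← integral_mul_const]
  congr 1 with y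
  simp only [ContinuousMap.star_apply, charFun_apply, map_mul, map_inv, Circle.coe_mul,
    Circle.coe_inv_eq_conj, RCLike.star_def, Complex.conj_conj]
  ring

end Translation
-- Averages are compact operators with continuous values
section Compactness

variable {G : Type*} [CommGroup G] [TopologicalSpace G] [IsTopologicalGroup G]
    [CompactSpace G] [MeasurableSpace G] [BorelSpace G] {p : ℝ≥0∞} [Fact (1 ≤ p)]

theorem integrable_continuousMap_mul (h : C(G, ℂ)) (f : Lp ℂ p (haarProb G)) :
    Integrable (fun y => h y * f y) (haarProb G) :=
  ((Lp.memLp f).integrable Fact.out).bdd_mul (c := ‖h‖)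
    (map_continuous h).measurable.aestronglyMeasurable
    (ae_of_all _ fun y => h.norm_coe_le_norm y)

theorem norm_integral_continuousMap_mul_le (h : C(G, ℂ)) (f : Lp ℂ p (haarProb G)) :
    ‖∫ y, h y * f y ∂(haarProb G)‖ ≤ ‖h‖ * ‖f‖ := by
  have hf : Integrable f (haarProb G) := (Lp.memLp f).integrable Fact.out
  have h2 : ∫ ω, ‖f ω‖ ∂(haarProb G) ≤ ‖f‖ := by
    rw [integral_norm_eq_lintegral_enorm hf.aestronglyMeasurable, ← eLpNorm_one_eq_lintegral_enorm,
      Lp.norm_def]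
    exact ENNReal.toReal_mono (Lp.eLpNorm_ne_top f)
      (eLpNorm_le_eLpNorm_of_exponent_le Fact.out (Lp.aestronglyMeasurable f))
  calc ‖∫ y, h y * f y ∂(haarProb G)‖ ≤ ∫ y, ‖h y * f y‖ ∂(haarProb G) :=
        norm_integral_le_integral_norm _
    _ ≤ ∫ y, ‖h‖ * ‖f y‖ ∂(haarProb G) := by
        refine integral_mono (integrable_continuousMap_mul h f).norm (hf.norm.const_mul _) fun y => ?_
        simp only [norm_mul]
        gcongr
        exact h.norm_coe_le_norm y
    _ ≤ ‖h‖ * ‖f‖ := by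
        rw [integral_const_mul]
        gcongr

/-- The function `y ↦ K (y * x⁻¹)`, depending continuously on `x`. -/
noncomputable def shiftedKernel (K : C(G, ℂ)) : C(G, C(G, ℂ)) :=
  (K.comp ⟨fun q : G × G => q.2 * q.1⁻¹, by fun_prop⟩).curry

theorem shiftedKernel_apply (K : C(G, ℂ)) (x y : G) : shiftedKernel K x y = K (y * x⁻¹) := rfl

theorem norm_kernelIntegral_sub_le (K : C(G, ℂ)) (f : Lp ℂ p (haarProb G)) (x x' : G) :
    ‖(∫ y, shiftedKernel K x y * f y ∂(haarProb G)) -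
      ∫ y, shiftedKernel K x' y * f y ∂(haarProb G)‖ ≤
      ‖shiftedKernel K x - shiftedKernel K x'‖ * ‖f‖ := by
  rw [← integral_sub (integrable_continuousMap_mul _ f) (integrable_continuousMap_mul _ f)]
  simpa only [ContinuousMap.sub_apply, sub_mul] using
    norm_integral_continuousMap_mul_le (shiftedKernel K x - shiftedKernel K x') f

variable (p) in
/-- The map `f ↦ (x ↦ ∫ K(y x⁻¹) f(y) dy)` from `L_p(G)` to `C(G)`. -/
noncomputable def kernelCLM (K : C(G, ℂ)) : Lp ℂ p (haarProb G) →L[ℂ] C(G, ℂ) :=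
  LinearMap.mkContinuous
    { toFun := fun f =>
        { toFun := fun x => ∫ y, shiftedKernel K x y * f y ∂(haarProb G)
          continuous_toFun := by
            refine continuous_iff_continuousAt.2 fun x => tendsto_iff_norm_sub_tendsto_zero.2 ?_
            refine squeeze_zero (fun _ => norm_nonneg _)
              (fun x' => norm_kernelIntegral_sub_le K f x' x) ?_
            have h := tendsto_iff_norm_sub_tendsto_zero.1
              ((map_continuous (shiftedKernel K)).tendsto x)
            simpa using h.mul_const ‖f‖ }
      map_add' := fun f g => by
        ext x
        refine Eq.trans ?_ (integral_add (integrable_continuousMap_mul (shiftedKernel K x) f)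
          (integrable_continuousMap_mul (shiftedKernel K x) g))
        refine integral_congr_ae ?_
        filter_upwards [Lp.coeFn_add f g] with y hy
        rw [hy, Pi.add_apply, mul_add]
      map_smul' := fun c f => by
        ext x
        refine Eq.trans ?_ (integral_const_mul c fun y => shiftedKernel K x y * f y)
        refine integral_congr_ae ?_
        filter_upwards [Lp.coeFn_smul c f] with y hy
        rw [hy, Pi.smul_apply, smul_eq_mul]
        ring }
    ‖shiftedKernel K‖ fun f => by
      refine (ContinuousMap.norm_le _ (by positivity)).2 fun x => ?_
      refine (norm_integral_continuousMap_mul_le _ f).trans ?_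
      gcongr
      exact (shiftedKernel K).norm_coe_le_norm x

theorem kernelCLM_apply (K : C(G, ℂ)) (f : Lp ℂ p (haarProb G)) (x : G) :
    kernelCLM p K f x = ∫ y, shiftedKernel K x y * f y ∂(haarProb G) := rfl

/-- Every average has a continuous representative; this is what later makes eigenvectors continuous.
-/
theorem classLp_kernelCLM (hp : p ≠ ∞) (K : C(G, ℂ)) (f : Lp ℂ p (haarProb G)) :
    classLp p (kernelCLM p K f) = average K f := by
  refine congrFun ((denseRange_classLp hp).equalizer
    ((classLp p).comp (kernelCLM p K)).continuous (averageCLM p hp K).continuous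
    (funext fun f => ?_)) f
  change classLp p (kernelCLM p K (classLp p f)) = average K (classLp p f)
  rw [average_classLp]
  congr 1
  ext x
  rw [integral_translate_apply, kernelCLM_apply]
  refine integral_congr_ae ?_
  filter_upwards [ContinuousMap.coeFn_toLp (p := p) (𝕜 := ℂ) (haarProb G) f] with y hy
  rw [hy, shiftedKernel_apply]

/-- Arzelà–Ascoli: on the unit ball the values are bounded by the norm of the kernel, and their
oscillation is controlled by that of `x ↦ K(· x⁻¹)` in `C(G)`, uniformly in `f`. -/
theorem isCompactOperator_kernelCLM (K : C(G, ℂ)) : IsCompactOperator (kernelCLM p K) := by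
  refine (isCompactOperator_iff_isCompact_closure_image_closedBall (𝕜₁ := ℂ)
    (kernelCLM p K).toLinearMap one_pos).2 ?_
  set e := (ContinuousMap.isometryEquivBoundedOfCompact G ℂ).toHomeomorph
  rw [← e.isCompact_image, e.image_closure]
  refine BoundedContinuousFunction.arzela_ascoli (Metric.closedBall 0 ‖shiftedKernel K‖)
    (isCompact_closedBall _ _) _ ?_ ?_
  · rintro _ x ⟨_, ⟨f, hf, rfl⟩, rfl⟩
    rw [mem_closedBall_zero_iff] at hf ⊢
    change ‖kernelCLM p K f x‖ ≤ _
    refine (norm_integral_continuousMap_mul_le _ f).trans ?_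
    refine (mul_le_of_le_one_right (norm_nonneg _) hf).trans ?_
    exact (shiftedKernel K).norm_coe_le_norm x
  · refine fun x => Metric.equicontinuousAt_iff_right.2 fun ε hε => ?_
    have h := Metric.tendsto_nhds.1 ((map_continuous (shiftedKernel K)).tendsto x) ε hε
    filter_upwards [h] with x' hx'
    rintro ⟨_, ⟨_, ⟨f, hf, rfl⟩, rfl⟩⟩
    rw [mem_closedBall_zero_iff] at hf
    rw [dist_comm, dist_eq_norm]
    change ‖kernelCLM p K f x' - kernelCLM p K f x‖ < ε
    refine (norm_kernelIntegral_sub_le K f x' x).trans_lt ?_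
    refine (mul_le_of_le_one_right (norm_nonneg _) hf).trans_lt ?_
    rwa [← dist_eq_norm]

theorem isCompactOperator_averageCLM (hp : p ≠ ∞) (K : C(G, ℂ)) :
    IsCompactOperator (averageCLM p hp K) := by
  have h : averageCLM p hp K = (classLp p).comp (kernelCLM p K) := by
    ext1 f
    exact (classLp_kernelCLM hp K f).symm
  rw [h]
  exact (isCompactOperator_kernelCLM (p := p) K).clm_comp (classLp p)

end Compactness

/-! ### Self-adjoint averages on `L_2(G)` -/

section Symmetric
variable {G : Type*} [CommGroup G] [TopologicalSpace G] [IsTopologicalGroup G]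
    [CompactSpace G] [MeasurableSpace G] [BorelSpace G]

/-- The adjoint of translation by `y` is translation by `y⁻¹`, and Haar measure is invariant under
inversion. -/
theorem isSymmetric_averageCLM {K : C(G, ℂ)} (hK : ∀ y, K y⁻¹ = conj (K y)) :
    (averageCLM (G := G) 2 ENNReal.ofNat_ne_top K).IsSymmetric := by
  intro f g
  have hp : (2 : ℝ≥0∞) ≠ ∞ := ENNReal.ofNat_ne_top
  change inner ℂ (average (p := 2) K f) g = inner ℂ f (average (p := 2) K g)
  have h1 : inner ℂ (average (p := 2) K f) g =
      ∫ y, inner ℂ (K y • translate y f) g ∂(haarProb G) := by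
    have h := (innerSL ℂ g).integral_comp_comm (continuous_smul_translate hp K f).integrable_haarProb
    rw [← inner_conj_symm]
    change conj (innerSL ℂ g (average K f)) = _
    rw [average, ← h, ← integral_conj]
    simp only [innerSL_apply_apply, inner_conj_symm]
  have h2 : inner ℂ f (average K g) = ∫ y, inner ℂ f (K y • translate y g) ∂(haarProb G) :=
    ((innerSL ℂ f).integral_comp_comm
      (continuous_smul_translate hp K g).integrable_haarProb).symm
  rw [h1, h2, ← integral_inv_eq_self (fun y => inner ℂ f (K y • translate y g))]
  congr 1 with y
  rw [inner_smul_left, inner_smul_right, hK, ← (translate y).inner_map_map f, translate_translate,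
    inv_mul_cancel, translate_one]

end Symmetric

/-! ### Approximate identities -/

section ApproximateIdentity
variable {G : Type*} [CommGroup G] [TopologicalSpace G] [IsTopologicalGroup G]
    [CompactSpace G] [T2Space G] [MeasurableSpace G] [BorelSpace G] {p : ℝ≥0∞} [Fact (1 ≤ p)]

theorem exists_symmetric_average_near (hp : p ≠ ∞) (f : Lp ℂ p (haarProb G)) {ε : ℝ} (hε : 0 < ε) :
    ∃ K : C(G, ℂ), (∀ y, K y⁻¹ = conj (K y)) ∧ ‖average K f - f‖ ≤ ε := by
  let U : Set G := {y | ‖translate y f - f‖ < ε}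
  have hUo : IsOpen U :=
    isOpen_lt ((continuous_translate hp f).sub continuous_const).norm continuous_const
  have h1U : (1 : G) ∈ U := by simpa [U, translate_one] using hε
  obtain ⟨b, hb1, hb0, -, hb⟩ := exists_continuous_one_zero_of_isCompact
    (isCompact_singleton (x := (1 : G))) (hUo.inter hUo.inv).isClosed_compl
    (by simpa using h1U)
  -- The bump `b` vanishes off `U ∩ U⁻¹`, so its symmetrization still vanishes off `U`. Dividing by
  -- the integral gives a probability density that only sees translates within `ε` of `f`.
  let k : G → ℝ := fun y => b y + b y⁻¹
  have hkc : Continuous k := by fun_prop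
  have hk0 : 0 ≤ k := fun y => add_nonneg (hb _).1 (hb _).1
  have hk1 : k 1 ≠ 0 := by
    have : b 1 = 1 := hb1 rfl
    simp [k, this]
  have hkU : ∀ y, y ∉ U → k y = 0 := by
    intro y hy
    have e1 : b y = 0 := hb0 fun h => hy h.1
    have e2 : b y⁻¹ = 0 := hb0 fun h => hy (by simpa using h.2)
    simp [k, e1, e2]
  have hI : 0 < ∫ y, k y ∂(haarProb G) :=
    hkc.integral_pos_of_hasCompactSupport_nonneg_nonzero (HasCompactSupport.of_compactSpace k) hk0 hk1
  set I := ∫ y, k y ∂(haarProb G)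
  let K : C(G, ℂ) := ⟨fun y => ((k y / I : ℝ) : ℂ), by fun_prop⟩
  have hK : ∀ y, K y = ((k y / I : ℝ) : ℂ) := fun _ => rfl
  have hKI : ∫ y, k y / I ∂(haarProb G) = 1 := by
    rw [integral_div, div_self hI.ne']
  refine ⟨K, fun y => ?_, ?_⟩
  · rw [hK, hK, Complex.conj_ofReal]
    simp [k, add_comm]
  · have h1 : f = ∫ y, K y • f ∂(haarProb G) := by
      rw [integral_smul_const]
      simp only [hK]
      rw [integral_complex_ofReal, hKI]
      simp
    have h2 : average K f - f = ∫ y, K y • (translate y f - f) ∂(haarProb G) := by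
      refine (congrArg (average K f - ·) h1).trans ?_
      simp only [smul_sub]
      exact (integral_sub (continuous_smul_translate hp K f).integrable_haarProb
        ((map_continuous K).smul (continuous_const (y := f))).integrable_haarProb).symm
    rw [h2]
    calc _ ≤ ∫ y, k y / I * ε ∂(haarProb G) := by
          refine norm_integral_le_of_norm_le ?_ (ae_of_all _ fun y => ?_)
          · exact (Continuous.integrable_haarProb (by fun_prop))
          · rw [norm_smul, hK, Complex.norm_real, Real.norm_of_nonneg (div_nonneg (hk0 y) hI.le)]
            by_cases hy : y ∈ U
            · have := div_nonneg (hk0 y) hI.le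
              gcongr
              exact (show ‖translate y f - f‖ < ε from hy).le
            · simp [hkU y hy]
      _ = ε := by rw [integral_mul_const, hKI, one_mul]

end ApproximateIdentity
-- Induction on dimension: if some `τ i` is not scalar on `E`, one of its eigenspaces in `E` is
-- proper, nonzero and, by commutativity, invariant under all the others.
theorem exists_joint_eigenvector {V ι : Type*} [AddCommGroup V] [Module ℂ V] (τ : ι → V →ₗ[ℂ] V)
    (hτ : ∀ i j v, τ i (τ j v) = τ j (τ i v)) :
    ∀ (n : ℕ) (E : Submodule ℂ V) [FiniteDimensional ℂ E], Module.finrank ℂ E = n → E ≠ ⊥ →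
      (∀ i, ∀ v ∈ E, τ i v ∈ E) → ∃ u ∈ E, u ≠ 0 ∧ ∀ i, ∃ c : ℂ, τ i u = c • u := by
  intro n
  induction n using Nat.strong_induction_on with
  | _ n ih =>
    intro E _ hn hE hinv
    by_cases hs : ∀ i, ∃ c : ℂ, ∀ v ∈ E, τ i v = c • v
    · obtain ⟨u, hu, hu0⟩ := E.exists_mem_ne_zero_of_ne_bot hE
      exact ⟨u, hu, hu0, fun i => (hs i).imp fun c hc => hc u hu⟩
    · push Not at hs
      obtain ⟨i, hi⟩ := hs
      have : Nontrivial E := Submodule.nontrivial_iff_ne_bot.2 hE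
      obtain ⟨c, hc⟩ := Module.End.exists_eigenvalue ((τ i).restrict (hinv i))
      obtain ⟨w, hw⟩ := hc.exists_hasEigenvector
      let E' : Submodule ℂ V := E ⊓ Module.End.eigenspace (τ i) c
      have hlt : E' < E := by
        refine lt_of_le_of_ne inf_le_left fun h => ?_
        obtain ⟨v, hv, hne⟩ := hi c
        rw [← h] at hv
        exact hne (Module.End.mem_eigenspace_iff.1 hv.2)
      have hfd : FiniteDimensional ℂ E' := Submodule.finiteDimensional_of_le hlt.le
      have hE' : E' ≠ ⊥ := by
        refine (Submodule.ne_bot_iff _).2 ⟨w, ⟨w.2, ?_⟩, fun h0 => hw.2 (Subtype.ext h0)⟩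
        exact Module.End.mem_eigenspace_iff.2 (congrArg Subtype.val hw.apply_eq_smul)
      have hinv' : ∀ j, ∀ v ∈ E', τ j v ∈ E' := by
        rintro j v ⟨hv, hv'⟩
        refine ⟨hinv j v hv, Module.End.mem_eigenspace_iff.2 ?_⟩
        rw [hτ, Module.End.mem_eigenspace_iff.1 hv', map_smul]
      obtain ⟨u, hu, h⟩ := ih (Module.finrank ℂ E') (hn ▸ Submodule.finrank_lt_finrank_of_lt hlt)
        E' rfl hE' hinv'
      exact ⟨u, hu.1, h⟩

/-! ### Peter–Weyl theory: characters determine functions -/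

section PeterWeyl

variable {G : Type*} [CommGroup G] [TopologicalSpace G] [IsTopologicalGroup G]
    [CompactSpace G] [MeasurableSpace G] [BorelSpace G]

/-- A continuous function which every translation multiplies by a scalar is a multiple of a
character. -/
theorem exists_char_of_forall_translate_eq {p : ℝ≥0∞} [Fact (1 ≤ p)] {u : C(G, ℂ)}
    (hu : u ≠ 0) (h : ∀ g, ∃ c : ℂ, translate g (classLp p u) = c • classLp p u) :
    ∃ γ : PontryaginDual G, charCoeff p γ (classLp p u) ≠ 0 := by
  choose c hc using h
  have hc' : ∀ g x, u (g * x) = c g * u x := by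
    intro g x
    have h1 := hc g
    rw [translate_classLp, ← map_smul] at h1
    exact DFunLike.congr_fun (ContinuousMap.toLp_injective (haarProb G) h1) x
  have hu1 : u 1 ≠ 0 := by
    intro h1
    apply hu
    ext x
    simpa [h1] using hc' x 1
  have hcu : ∀ g, c g = u g / u 1 := fun g => by
    rw [eq_div_iff hu1, ← hc', mul_one]
  have hcn : ∀ g, ‖c g‖ = 1 := by
    intro g
    have h0 : ‖classLp p u‖ ≠ 0 := by
      rw [norm_ne_zero_iff]
      intro h0
      exact hu (ContinuousMap.toLp_injective (haarProb G) (h0.trans (map_zero (classLp p)).symm))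
    have h2 := congrArg norm (hc g)
    rw [LinearIsometry.norm_map, norm_smul] at h2
    exact (mul_right_cancel₀ h0 (by rw [one_mul]; exact h2)).symm
  have hcm : ∀ g g', c (g * g') = c g * c g' := by
    intro g g'
    rw [hcu (g * g'), hc', hcu g']
    ring
  -- The multiplier is `u / u 1`: continuous because `u` is, multiplicative by the functional
  -- equation, unimodular because translations are isometries.
  let γ : PontryaginDual G :=
    { toFun := fun g => ⟨c g, mem_sphere_zero_iff_norm.2 (hcn g)⟩
      map_one' := Circle.ext (by simp [hcu, hu1])
      map_mul' := fun g g' => Circle.ext (hcm g g')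
      continuous_toFun := by
        refine Continuous.subtype_mk (f := c) ?_ _
        rw [funext hcu]
        exact (map_continuous u).div_const _ }
  refine ⟨γ, ?_⟩
  have hγ : ∀ x, ((γ x : Circle) : ℂ) = c x := fun _ => rfl
  rw [charCoeff_classLp]
  have : ∀ x, u x * conj ((γ x : Circle) : ℂ) = u 1 := by
    intro x
    have h1 : u x = u 1 * ((γ x : Circle) : ℂ) := by
      rw [hγ, hcu, mul_div_cancel₀ _ hu1]
    rw [h1, mul_assoc, Complex.mul_conj, Circle.normSq_coe]
    simp
  simp [this, hu1]

variable [T2Space G]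

/-- A function in `L_2(G)` is determined by its Fourier coefficients. -/
theorem eq_zero_of_charCoeff_two_eq_zero (f : Lp ℂ 2 (haarProb G))
    (hf : ∀ γ, charCoeff 2 γ f = 0) : f = 0 := by
  have hp : (2 : ℝ≥0∞) ≠ ∞ := ENNReal.ofNat_ne_top
  by_contra hf0
  let W : Submodule ℂ (Lp ℂ 2 (haarProb G)) := ⨅ γ, LinearMap.ker (charCoeff 2 γ)
  have hW : ∀ g, g ∈ W ↔ ∀ γ, charCoeff 2 γ g = 0 := fun g => by simp [W]
  have hWc : IsClosed (W : Set (Lp ℂ 2 (haarProb G))) := by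
    have : (W : Set (Lp ℂ 2 (haarProb G))) = ⋂ γ, {g | charCoeff 2 γ g = 0} := by
      ext g
      simp [hW]
    rw [this]
    exact isClosed_iInter fun γ => isClosed_eq (continuous_charCoeff γ) continuous_const
  have : CompleteSpace W := hWc.completeSpace_coe
  obtain ⟨K, hK, hKf⟩ := exists_symmetric_average_near hp f (half_pos (norm_pos_iff.2 hf0))
  set T := averageCLM (G := G) 2 hp K with hT
  have hTW : ∀ g ∈ W, T g ∈ W := fun g hg => (hW _).2 fun γ => by
    rw [hT, averageCLM_apply, charCoeff_average hp, (hW _).1 hg, mul_zero]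
  have hTc : IsCompactOperator T := isCompactOperator_averageCLM hp K
  have hTs : T.IsSymmetric := isSymmetric_averageCLM hK
  -- `S` is nonzero because `T f` lies within `‖f‖ / 2` of `f`. A nonzero compact symmetric operator
  -- has a nonzero eigenvalue, and the corresponding eigenspace of `T` is finite-dimensional.
  let S : W →L[ℂ] W := T.restrict hTW
  have hS0 : S ≠ 0 := by
    intro h
    have h1 : average K f = 0 :=
      congrArg Subtype.val (DFunLike.congr_fun h (⟨f, (hW f).2 hf⟩ : W))
    rw [h1, zero_sub, norm_neg] at hKf
    have := norm_pos_iff.2 hf0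
    linarith
  have hSc : IsCompactOperator S := hTc.restrict' hTW
  have hSs : S.IsSymmetric := hTs.restrict_invariant hTW
  have hμ : ∃ μ, Module.End.HasEigenvalue (S : Module.End ℂ W) μ ∧ μ ≠ 0 := by
    by_contra h
    push Not at h
    exact hS0 ((ContinuousLinearMap.eq_zero_of_forall_hasEigenvalue_eq_zero hSc hSs).1 h)
  obtain ⟨μ, hμ, hμ0⟩ := hμ
  obtain ⟨w, hw⟩ := hμ.exists_hasEigenvector
  have hfd := ContinuousLinearMap.finite_dimensional_eigenspace hTc μ hμ0
  let E := Module.End.eigenspace T.toLinearMap μ ⊓ W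
  have hEfd : FiniteDimensional ℂ E := Submodule.finiteDimensional_of_le inf_le_left
  obtain ⟨u, ⟨huE, huW⟩, hu0, hu⟩ := exists_joint_eigenvector
    (fun g : G => (translate (p := 2) g).toLinearMap)
    (fun g h v => by simp [translate_translate, mul_comm]) _ E rfl
    ((Submodule.ne_bot_iff _).2 ⟨w, ⟨Module.End.mem_eigenspace_iff.2
      (congrArg Subtype.val hw.apply_eq_smul), w.2⟩, fun h0 => hw.2 (Subtype.ext h0)⟩)
    (by
      rintro g v ⟨hv, hv'⟩
      refine ⟨Module.End.mem_eigenspace_iff.2 ?_, (hW _).2 fun γ => ?_⟩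
      · have h1 : average K v = μ • v := Module.End.mem_eigenspace_iff.1 hv
        change average K (translate g v) = μ • translate g v
        rw [← translate_average hp, h1, map_smul]
      · change charCoeff 2 γ (translate g v) = 0
        rw [charCoeff_translate, (hW _).1 hv', mul_zero])
  have hu1 : u = classLp 2 (μ⁻¹ • kernelCLM 2 K u) := by
    have h1 : average K u = μ • u := Module.End.mem_eigenspace_iff.1 huE
    rw [map_smul, classLp_kernelCLM hp, h1, inv_smul_smul₀ hμ0]
  obtain ⟨γ, hγ⟩ := exists_char_of_forall_translate_eq (p := 2) (u := μ⁻¹ • kernelCLM 2 K u)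
    (by
      intro h
      rw [h, map_zero] at hu1
      exact hu0 hu1) (by rw [← hu1]; exact hu)
  rw [← hu1] at hγ
  exact hγ ((hW u).1 huW γ)

/-- If all characters agreed at `x` and `y`, the two translates of any continuous function would
have equal Fourier coefficients and hence coincide; a Urysohn function rules this out. -/
theorem exists_char_apply_ne {x y : G} (hxy : x ≠ y) : ∃ γ : PontryaginDual G, γ x ≠ γ y := by
  by_contra h
  push Not at h
  obtain ⟨f, hf⟩ : ∃ f : C(G, ℂ), f x ≠ f y := by
    obtain ⟨b, hb0, hb1, -⟩ := exists_continuous_zero_one_of_isClosed (X := G)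
      (isClosed_singleton (x := x)) (isClosed_singleton (x := y)) (by simpa using hxy)
    refine ⟨⟨fun z => (b z : ℂ), by fun_prop⟩, ?_⟩
    have h0 : b x = 0 := hb0 rfl
    have h1 : b y = 1 := hb1 rfl
    simp [h0, h1]
  have h1 : translate x (classLp 2 f) - translate y (classLp 2 f) = 0 := by
    refine eq_zero_of_charCoeff_two_eq_zero _ fun γ => ?_
    rw [map_sub, charCoeff_translate, charCoeff_translate, h, sub_self]
  rw [sub_eq_zero, translate_classLp, translate_classLp] at h1
  have h2 := DFunLike.congr_fun (ContinuousMap.toLp_injective (haarProb G) h1) 1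
  exact hf (by simpa using h2)

/-- Trigonometric polynomials are dense in `C(G)`. -/
theorem span_charFun_dense :
    (Submodule.span ℂ (Set.range (charFun (G := G)))).topologicalClosure = ⊤ := by
  -- Characters are closed under products, so the algebra they generate is just their linear span.
  let M : Submonoid C(G, ℂ) :=
    { carrier := Set.range charFun
      one_mem' := ⟨1, by ext; simp⟩
      mul_mem' := by
        rintro _ _ ⟨γ, rfl⟩ ⟨η, rfl⟩
        exact ⟨γ * η, by ext x; exact Circle.coe_mul _ _⟩ }
  let A : StarSubalgebra ℂ C(G, ℂ) :=
    { Algebra.adjoin ℂ (M : Set C(G, ℂ)) with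
      star_mem' := by
        intro a ha
        change a ∈ Algebra.adjoin ℂ (M : Set C(G, ℂ)) at ha
        change star a ∈ Algebra.adjoin ℂ (M : Set C(G, ℂ))
        induction ha using Algebra.adjoin_induction with
        | mem x hx =>
          obtain ⟨γ, rfl⟩ := hx
          refine Algebra.subset_adjoin ⟨γ⁻¹, ?_⟩
          ext x
          exact Circle.coe_inv_eq_conj _
        | algebraMap r =>
          rw [← algebraMap_star_comm]
          exact Subalgebra.algebraMap_mem _ _
        | add x y _ _ hx hy => rw [star_add]; exact add_mem hx hy
        | mul x y _ _ hx hy => rw [star_mul]; exact mul_mem hy hx }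
  have hA : (A : Set C(G, ℂ)) = Submodule.span ℂ (Set.range (charFun (G := G))) := by
    change ((Algebra.adjoin ℂ (M : Set C(G, ℂ))).toSubmodule : Set C(G, ℂ)) = _
    rw [Algebra.adjoin_eq_span, Submonoid.closure_eq]
    rfl
  have h := ContinuousMap.starSubalgebra_topologicalClosure_eq_top_of_separatesPoints A
    (fun x y hxy => by
      obtain ⟨γ, hγ⟩ := exists_char_apply_ne hxy
      exact ⟨charFun γ, ⟨charFun γ, Algebra.subset_adjoin ⟨γ, rfl⟩, rfl⟩,
        fun h => hγ (Circle.ext h)⟩)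
  refine SetLike.coe_injective ?_
  rw [Submodule.topologicalClosure_coe, ← hA, ← StarSubalgebra.topologicalClosure_coe, h]
  rfl

variable {p : ℝ≥0∞} [Fact (1 ≤ p)]

/-- Every `f ∈ L_p(G)` is a limit of trigonometric polynomials with spectrum in that of `f`. -/
theorem mem_closure_span_spectrum (hp : p ≠ ∞) (f : Lp ℂ p (haarProb G)) :
    f ∈ closure (Submodule.span ℂ
      ((fun γ => classLp p (charFun γ)) '' {γ | charCoeff p γ f ≠ 0}) :
      Set (Lp ℂ p (haarProb G))) := by
  set V := Submodule.span ℂ ((fun γ => classLp p (charFun γ)) '' {γ | charCoeff p γ f ≠ 0})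
  have hV : ∀ K ∈ Submodule.span ℂ (Set.range (charFun (G := G))), average K f ∈ V := by
    intro K hK
    induction hK using Submodule.span_induction with
    | mem x hx =>
      obtain ⟨γ, rfl⟩ := hx
      have h1 : charFun γ = star (charFun γ⁻¹) := by
        ext x
        change _ = conj (((γ⁻¹ : PontryaginDual G) x : Circle) : ℂ)
        have : (γ⁻¹ : PontryaginDual G) x = (γ x)⁻¹ := rfl
        rw [this, Circle.coe_inv_eq_conj, Complex.conj_conj]
        rfl
      rw [h1, average_conj_char hp]
      by_cases h0 : charCoeff p γ⁻¹ f = 0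
      · rw [h0, zero_smul]
        exact zero_mem _
      · exact V.smul_mem _ (Submodule.subset_span ⟨γ⁻¹, h0, rfl⟩)
    | zero =>
      rw [← zero_smul ℂ (0 : C(G, ℂ)), average_smul, zero_smul]
      exact zero_mem _
    | add x y _ _ hx hy =>
      rw [average_add hp]
      exact add_mem hx hy
    | smul a x _ hx =>
      rw [average_smul]
      exact V.smul_mem _ hx
  refine Metric.mem_closure_iff.2 fun ε hε => ?_
  obtain ⟨K, -, hK⟩ := exists_symmetric_average_near hp f (show 0 < ε / 3 by positivity)
  have hKd : K ∈ closure (Submodule.span ℂ (Set.range (charFun (G := G))) : Set C(G, ℂ)) := by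
    rw [← Submodule.topologicalClosure_coe, span_charFun_dense]
    trivial
  -- The `+ 1` keeps the tolerance meaningful when `f = 0`.
  obtain ⟨L, hL, hLK⟩ := Metric.mem_closure_iff.1 hKd (ε / 3 / (‖f‖ + 1)) (by positivity)
  refine ⟨average L f, hV L hL, ?_⟩
  have h1 : ‖average K f - average L f‖ ≤ ε / 3 := by
    rw [← average_sub hp]
    refine (norm_average_le _ _).trans ?_
    rw [← dist_eq_norm]
    calc dist K L * ‖f‖ ≤ ε / 3 / (‖f‖ + 1) * (‖f‖ + 1) := by
          gcongr
          linarith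
      _ = ε / 3 := by field_simp
  rw [dist_comm, dist_eq_norm]
  calc ‖average L f - f‖ = ‖(average K f - f) - (average K f - average L f)‖ := by
        congr 1; abel
    _ ≤ ε / 3 + ε / 3 := (norm_sub_le _ _).trans (add_le_add hK h1)
    _ < ε := by linarith

end PeterWeyl
-- Mean value inequality for subharmonic functions
/-- `Φ` is a twice continuously differentiable subharmonic function on the plane, with first and
second differentials `D` and `Q`. -/
structure IsSubharmonicC2 (Φ : ℂ → ℝ) (D : ℂ → ℂ → ℝ) (Q : ℂ → ℂ → ℂ → ℝ) : Prop where
  continuous : Continuous Φ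
  continuous_fst : Continuous fun q : ℂ × ℂ => D q.1 q.2
  continuous_snd : Continuous fun q : ℂ × ℂ × ℂ => Q q.1 q.2.1 q.2.2
  fst_neg : ∀ z h, D z (-h) = -D z h
  hasDerivAt : ∀ {c : ℝ → ℂ} {c' : ℂ} {t : ℝ}, HasDerivAt c c' t →
    HasDerivAt (fun t => Φ (c t)) (D (c t) c') t
  hasDerivAt_fst : ∀ {c d : ℝ → ℂ} {c' d' : ℂ} {t : ℝ}, HasDerivAt c c' t → HasDerivAt d d' t →
    HasDerivAt (fun t => D (c t) (d t)) (Q (c t) (d t) c' + D (c t) d') t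
  laplacian_nonneg : ∀ z h, 0 ≤ Q z h h + Q z (Complex.I * h) (Complex.I * h)

theorem IsSubharmonicC2.continuous_fst_comp {X : Type*} [TopologicalSpace X] {Φ : ℂ → ℝ}
    {D : ℂ → ℂ → ℝ} {Q : ℂ → ℂ → ℂ → ℝ} (hΦ : IsSubharmonicC2 Φ D Q) {f g : X → ℂ}
    (hf : Continuous f) (hg : Continuous g) : Continuous fun x => D (f x) (g x) :=
  hΦ.continuous_fst.comp (hf.prodMk hg)

theorem IsSubharmonicC2.continuous_snd_comp {X : Type*} [TopologicalSpace X] {Φ : ℂ → ℝ}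
    {D : ℂ → ℂ → ℝ} {Q : ℂ → ℂ → ℂ → ℝ} (hΦ : IsSubharmonicC2 Φ D Q) {f g h : X → ℂ}
    (hf : Continuous f) (hg : Continuous g) (hh : Continuous h) :
    Continuous fun x => Q (f x) (g x) (h x) :=
  hΦ.continuous_snd.comp (hf.prodMk (hg.prodMk hh))

/-- A convex function with a positive slope anywhere lies above a rising tangent line and tends to
infinity; having a finite limit, `m` must be nonincreasing. -/
theorem le_apply_zero_of_tendsto_of_convex {m m₁ m₂ : ℝ → ℝ} {L : ℝ}
    (h₁ : ∀ t, HasDerivAt m (m₁ t) t) (h₂ : ∀ t, HasDerivAt m₁ (m₂ t) t) (h₃ : ∀ t, 0 ≤ m₂ t)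
    (hL : Tendsto m atTop (𝓝 L)) : L ≤ m 0 := by
  have hmono : Monotone m₁ := monotone_of_hasDerivAt_nonneg h₂ h₃
  have hneg : ∀ t, m₁ t ≤ 0 := by
    intro t
    by_contra! ht
    have hle : ∀ s ∈ Set.Ici t, m t + m₁ t * (s - t) ≤ m s := by
      intro s hs
      have := Convex.mul_sub_le_image_sub_of_le_deriv (convex_Ici t)
        (fun s _ => (h₁ s).continuousAt.continuousWithinAt)
        (fun s _ => (h₁ s).differentiableAt.differentiableWithinAt) (C := m₁ t)
        (fun s hs => by
          rw [(h₁ s).deriv]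
          exact hmono (interior_subset hs)) t Set.self_mem_Ici s hs hs
      linarith
    have hT : Tendsto (fun s => m t + m₁ t * (s - t)) atTop atTop :=
      tendsto_atTop_add_const_left _ _ <| Tendsto.const_mul_atTop ht <|
        tendsto_atTop_add_const_right _ _ tendsto_id
    exact not_tendsto_nhds_of_tendsto_atTop
      (tendsto_atTop_mono' _ ((eventually_ge_atTop t).mono hle) hT) L hL
  exact (antitone_of_hasDerivAt_nonpos h₁ hneg).le_of_tendsto hL 0

section Exponentials

variable {G : Type*} [CommGroup G] [TopologicalSpace G] [IsTopologicalGroup G]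
    [CompactSpace G] [MeasurableSpace G] [BorelSpace G]

theorem hasDerivAt_integral_haarProb {F F' : ℝ → G → ℝ}
    (hF : Continuous fun q : ℝ × G => F q.1 q.2) (hF' : Continuous fun q : ℝ × G => F' q.1 q.2)
    (h : ∀ t x, HasDerivAt (fun t => F t x) (F' t x) t) (t : ℝ) :
    HasDerivAt (fun t => ∫ x, F t x ∂(haarProb G)) (∫ x, F' t x ∂(haarProb G)) t := by
  obtain ⟨C, hC⟩ := ((isCompact_closedBall t 1).prod (isCompact_univ (X := G))).exists_bound_of_continuousOn
    hF'.continuousOn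
  refine (hasDerivAt_integral_of_dominated_loc_of_deriv_le (bound := fun _ => C)
    (Metric.closedBall_mem_nhds t one_pos) (Eventually.of_forall fun s => ?_) ?_ ?_
    (ae_of_all _ fun x s hs => hC (s, x) ⟨hs, trivial⟩) (integrable_const C)
    (ae_of_all _ fun x s _ => h s x)).2
  · exact (Continuous.integrable_haarProb (f := F s)
      (hF.comp (by fun_prop : Continuous fun x : G => (s, x)))).aestronglyMeasurable
  · exact Continuous.integrable_haarProb (f := F t)
      (hF.comp (by fun_prop : Continuous fun x : G => (t, x)))
  · exact (Continuous.integrable_haarProb (f := F' t)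
      (hF'.comp (by fun_prop : Continuous fun x : G => (t, x)))).aestronglyMeasurable

variable {ι : Type*} (s : Finset ι) (χ : ι → PontryaginDual G) (μ : ι → ℝ)

/-- The trigonometric polynomial `∑ c j e^(-μ j σ) χ j`, continued to the half-plane. -/
noncomputable def dampedSum (c : ι → ℂ) (σ : ℝ) (x : G) : ℂ :=
  ∑ j ∈ s, c j * Complex.exp (-(μ j * σ : ℝ)) * (χ j x : ℂ)

theorem continuous_dampedSum (c : ι → ℂ) :
    Continuous fun q : ℝ × G => dampedSum s χ μ c q.1 q.2 := by
  unfold dampedSum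
  refine continuous_finsetSum _ fun j _ => ?_
  refine Continuous.mul (by fun_prop) ((map_continuous (charFun (χ j))).comp continuous_snd)

theorem hasDerivAt_dampedSum (c : ι → ℂ) (σ : ℝ) (x : G) :
    HasDerivAt (fun σ => dampedSum s χ μ c σ x)
      (dampedSum s χ μ (fun j => -(μ j) * c j) σ x) σ := by
  unfold dampedSum
  refine HasDerivAt.fun_sum fun j _ => ?_
  have h1 : HasDerivAt (fun σ : ℝ => ((μ j * σ : ℝ) : ℂ)) (μ j : ℂ) σ := by
    simpa using ((hasDerivAt_id σ).const_mul (μ j)).ofReal_comp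
  refine ((h1.fun_neg.cexp.const_mul (c j)).mul_const (χ j x : ℂ)).congr_deriv ?_
  ring

variable {β : Multiplicative ℝ →ₜ* G} {χ μ}

/-- The Cauchy–Riemann equation: the derivative along the flow is `I` times the derivative in `σ`.
-/
theorem hasDerivAt_dampedSum_flow
    (hχ : ∀ j, ∀ t : ℝ, χ j (β (Multiplicative.ofAdd t)) = Circle.exp (-(μ j * t)))
    (c : ι → ℂ) (σ : ℝ) (x : G) (t : ℝ) :
    HasDerivAt (fun t => dampedSum s χ μ c σ (β (Multiplicative.ofAdd t) * x))
      (Complex.I * dampedSum s χ μ (fun j => -(μ j) * c j) σ (β (Multiplicative.ofAdd t) * x))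
      t := by
  simp only [dampedSum, Finset.mul_sum]
  refine HasDerivAt.fun_sum fun j _ => ?_
  simp only [map_mul, hχ, Circle.coe_mul, Circle.coe_exp]
  have h1 : HasDerivAt (fun t : ℝ => ((-(μ j * t) : ℝ) : ℂ)) (-(μ j : ℂ)) t := by
    simpa using ((hasDerivAt_id t).const_mul (μ j)).fun_neg.ofReal_comp
  refine (((h1.mul_const Complex.I).cexp.mul_const (χ j x : ℂ)).const_mul
    (c j * Complex.exp (-(μ j * σ : ℝ)))).congr_deriv ?_
  ring

variable {Φ : ℂ → ℝ} {D : ℂ → ℂ → ℝ} {Q : ℂ → ℂ → ℂ → ℝ}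

/-- The integrand is the second derivative of `Φ ∘ E₀` along the flow. By invariance the integral of
the first derivative does not depend on `t`, so its `t`-derivative vanishes. -/
theorem integral_laplacian_tangential (hΦ : IsSubharmonicC2 Φ D Q) {E₀ E₁ E₂ : G → ℂ}
    (h₀ : Continuous E₀) (h₁ : Continuous E₁) (h₂ : Continuous E₂)
    (hd₀ : ∀ t x, HasDerivAt (fun t => E₀ (β (Multiplicative.ofAdd t) * x))
      (Complex.I * E₁ (β (Multiplicative.ofAdd t) * x)) t)
    (hd₁ : ∀ t x, HasDerivAt (fun t => E₁ (β (Multiplicative.ofAdd t) * x))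
      (Complex.I * E₂ (β (Multiplicative.ofAdd t) * x)) t) :
    ∫ x, (Q (E₀ x) (Complex.I * E₁ x) (Complex.I * E₁ x) - D (E₀ x) (E₂ x)) ∂(haarProb G) = 0 := by
  have hβ : Continuous fun q : ℝ × G => β (Multiplicative.ofAdd q.1) * q.2 :=
    ((map_continuous β).comp (continuous_ofAdd.comp continuous_fst)).mul continuous_snd
  have hI₁ : Continuous fun x => Complex.I * E₁ x := continuous_const.mul h₁
  have hI₂ : Continuous fun x => Complex.I * (Complex.I * E₂ x) :=
    continuous_const.mul (continuous_const.mul h₂)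
  let F : G → ℝ := fun x => D (E₀ x) (Complex.I * E₁ x)
  let F' : G → ℝ := fun y => Q (E₀ y) (Complex.I * E₁ y) (Complex.I * E₁ y) +
      D (E₀ y) (Complex.I * (Complex.I * E₂ y))
  have hF : Continuous F := hΦ.continuous_fst_comp h₀ hI₁
  have hF' : Continuous F' :=
    (hΦ.continuous_snd_comp h₀ hI₁ hI₁).add (hΦ.continuous_fst_comp h₀ hI₂)
  have h := hasDerivAt_integral_haarProb (G := G)
    (F := fun t x => F (β (Multiplicative.ofAdd t) * x))
    (F' := fun t x => F' (β (Multiplicative.ofAdd t) * x))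
    (hF.comp hβ) (hF'.comp hβ)
    (fun t x => hΦ.hasDerivAt_fst (hd₀ t x) ((hd₁ t x).const_mul Complex.I)) 0
  simp only [integral_mul_left_eq_self] at h
  have h0 := h.unique (hasDerivAt_const _ _)
  rw [← h0]
  congr 1 with x
  simp only [F']
  rw [← mul_assoc, Complex.I_mul_I, neg_one_mul, hΦ.fst_neg, sub_eq_add_neg]

/-- The mean value inequality for subharmonic functions of an analytic trigonometric polynomial. -/
theorem IsSubharmonicC2.le_integral
    (hχ : ∀ j, ∀ t : ℝ, χ j (β (Multiplicative.ofAdd t)) = Circle.exp (-(μ j * t)))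
    (hΦ : IsSubharmonicC2 Φ D Q) (hμ : ∀ j ∈ s, 0 < μ j) (c : ι → ℂ) :
    Φ 0 ≤ ∫ x, Φ (∑ j ∈ s, c j * (χ j x : ℂ)) ∂(haarProb G) := by
  -- `E k` is the `k`-th derivative in `σ` of the damped polynomial.
  obtain ⟨E, hEdef⟩ : ∃ E : ℕ → ℝ → G → ℂ,
    E = fun k => dampedSum s χ μ (fun j => (-(μ j)) ^ k * c j) := ⟨_, rfl⟩
  have hE : ∀ k, Continuous fun q : ℝ × G => E k q.1 q.2 := fun k => by
    rw [hEdef]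
    exact continuous_dampedSum s χ μ _
  have hshift : ∀ k : ℕ, (fun j => -(μ j : ℂ) * ((-(μ j)) ^ k * c j)) =
      fun j => (-(μ j)) ^ (k + 1) * c j := fun k => funext fun j => by ring
  have hd : ∀ k t x, HasDerivAt (fun t => E k t x) (E (k + 1) t x) t := by
    intro k t x
    rw [hEdef]
    simp only [← hshift k]
    exact hasDerivAt_dampedSum s χ μ _ t x
  have hdf : ∀ k σ t x, HasDerivAt (fun t => E k σ (β (Multiplicative.ofAdd t) * x))
      (Complex.I * E (k + 1) σ (β (Multiplicative.ofAdd t) * x)) t := by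
    intro k σ t x
    rw [hEdef]
    simp only [← hshift k]
    exact hasDerivAt_dampedSum_flow s hχ _ σ x t
  have hE0 : ∀ x, E 0 0 x = ∑ j ∈ s, c j * (χ j x : ℂ) := by
    intro x
    simp [hEdef, dampedSum]
  have hbound : ∀ t x, 0 ≤ t → ‖E 0 t x‖ ≤ ∑ j ∈ s, ‖c j‖ := by
    intro t x ht
    rw [hEdef]
    refine (norm_sum_le _ _).trans (Finset.sum_le_sum fun j hj => ?_)
    simp only [pow_zero, one_mul]
    rw [norm_mul, norm_mul, Circle.norm_coe, mul_one, ← Complex.ofReal_neg,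
      Complex.norm_exp_ofReal]
    refine mul_le_of_le_one_right (norm_nonneg _) (Real.exp_le_one_iff.2 ?_)
    have := mul_nonneg (hμ j hj).le ht
    linarith
  have hzero : ∀ x, Tendsto (fun t => E 0 t x) atTop (𝓝 0) := by
    intro x
    have : Tendsto (fun t => E 0 t x) atTop (𝓝 (∑ j ∈ s, 0)) := by
      rw [hEdef]
      refine tendsto_finsetSum _ fun j hj => ?_
      have h1 : Tendsto (fun t : ℝ => Real.exp (-(μ j * t))) atTop (𝓝 0) :=
        Real.tendsto_exp_neg_atTop_nhds_zero.comp (tendsto_id.const_mul_atTop (hμ j hj))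
      have h2 := ((Complex.continuous_ofReal.tendsto 0).comp h1).const_mul
        ((-(μ j : ℂ)) ^ 0 * c j)
      simpa using h2.mul_const (χ j x : ℂ)
    simpa using this
  clear hEdef
  have hI1 : Continuous fun q : ℝ × G => Complex.I * E 1 q.1 q.2 := continuous_const.mul (hE 1)
  have hc1 : Continuous fun q : ℝ × G => D (E 0 q.1 q.2) (E 1 q.1 q.2) :=
    hΦ.continuous_fst_comp (hE 0) (hE 1)
  have hcQ : Continuous fun q : ℝ × G => Q (E 0 q.1 q.2) (E 1 q.1 q.2) (E 1 q.1 q.2) :=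
    hΦ.continuous_snd_comp (hE 0) (hE 1) (hE 1)
  have hcI : Continuous fun q : ℝ × G =>
      Q (E 0 q.1 q.2) (Complex.I * E 1 q.1 q.2) (Complex.I * E 1 q.1 q.2) :=
    hΦ.continuous_snd_comp (hE 0) hI1 hI1
  have hc2 : Continuous fun q : ℝ × G => D (E 0 q.1 q.2) (E 2 q.1 q.2) :=
    hΦ.continuous_fst_comp (hE 0) (hE 2)
  have hcΦ : Continuous fun q : ℝ × G => Φ (E 0 q.1 q.2) := hΦ.continuous.comp (hE 0)
  have hs : ∀ t : ℝ, Continuous fun x : G => (t, x) := fun t => by fun_prop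
  have key := le_apply_zero_of_tendsto_of_convex (L := Φ 0)
    (hasDerivAt_integral_haarProb (G := G) (F := fun t x => Φ (E 0 t x))
      (F' := fun t x => D (E 0 t x) (E 1 t x)) hcΦ
      hc1 fun t x => hΦ.hasDerivAt (hd 0 t x))
    (hasDerivAt_integral_haarProb (F := fun t x => D (E 0 t x) (E 1 t x))
      (F' := fun t x => Q (E 0 t x) (E 1 t x) (E 1 t x) + D (E 0 t x) (E 2 t x)) hc1 (hcQ.add hc2)
      fun t x => hΦ.hasDerivAt_fst (hd 0 t x) (hd 1 t x)) ?_ ?_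
  · simpa only [hE0] using key
  · intro t
    have h1 := integral_laplacian_tangential hΦ ((hE 0).comp (hs t)) ((hE 1).comp (hs t))
      ((hE 2).comp (hs t)) (hdf 0 t) (hdf 1 t)
    -- Adding the vanishing tangential integral cancels the `D` term and completes the second
    -- derivative to a Laplacian.
    have h2 : ∫ x, (Q (E 0 t x) (E 1 t x) (E 1 t x) + D (E 0 t x) (E 2 t x)) ∂(haarProb G) =
        ∫ x, (Q (E 0 t x) (E 1 t x) (E 1 t x) +
          Q (E 0 t x) (Complex.I * E 1 t x) (Complex.I * E 1 t x)) ∂(haarProb G) := by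
      rw [← add_zero (∫ x, (Q (E 0 t x) (E 1 t x) (E 1 t x) + D (E 0 t x) (E 2 t x)) ∂(haarProb G)),
        ← h1]
      refine (integral_add (((hcQ.add hc2).comp (hs t)).integrable_haarProb)
        (((hcI.sub hc2).comp (hs t)).integrable_haarProb)).symm.trans ?_
      congr 1 with x
      change (Q (E 0 t x) (E 1 t x) (E 1 t x) + D (E 0 t x) (E 2 t x)) +
        (Q (E 0 t x) (Complex.I * E 1 t x) (Complex.I * E 1 t x) - D (E 0 t x) (E 2 t x)) = _
      ring
    rw [h2]
    exact integral_nonneg fun x => hΦ.laplacian_nonneg _ _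
  · obtain ⟨C, hC⟩ := (isCompact_closedBall (0 : ℂ) (∑ j ∈ s, ‖c j‖)).exists_bound_of_continuousOn
      hΦ.continuous.continuousOn
    have hlim : Tendsto (fun t => ∫ x, Φ (E 0 t x) ∂(haarProb G)) atTop
        (𝓝 (∫ _, Φ 0 ∂(haarProb G))) := by
      refine tendsto_integral_filter_of_dominated_convergence (fun _ => C)
        (Eventually.of_forall fun t => ?_) ?_ (integrable_const C)
        (ae_of_all _ fun x => (hΦ.continuous.tendsto 0).comp (hzero x))
      · exact ((hcΦ.comp (hs t)).integrable_haarProb).aestronglyMeasurable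
      · filter_upwards [eventually_ge_atTop 0] with t ht
        exact ae_of_all _ fun x => hC _ (mem_closedBall_zero_iff.2 (hbound t x ht))
    simpa using hlim

end Exponentials
-- The subharmonic test functions
theorem hasDerivAt_re_comp {c : ℝ → ℂ} {c' : ℂ} {t : ℝ} (h : HasDerivAt c c' t) :
    HasDerivAt (fun t => (c t).re) c'.re t :=
  Complex.reCLM.hasFDerivAt.comp_hasDerivAt t h

theorem hasDerivAt_im_comp {c : ℝ → ℂ} {c' : ℂ} {t : ℝ} (h : HasDerivAt c c' t) :
    HasDerivAt (fun t => (c t).im) c'.im t :=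
  Complex.imCLM.hasFDerivAt.comp_hasDerivAt t h

/-- The regularized square modulus `|z|² + ε`. -/
noncomputable def regSq (ε : ℝ) (z : ℂ) : ℝ := z.re ^ 2 + z.im ^ 2 + ε

theorem regSq_pos {ε : ℝ} (hε : 0 < ε) (z : ℂ) : 0 < regSq ε z := by
  unfold regSq
  positivity

/-- This is the case `p = 2q ≥ 2`. At `ε = 0` the Laplacian of `|z|^(2q)` is `4 q² |z|^(2q-2)`; the
factor `2 q²` makes the term from differentiating `x²` twice cancel it, and the remaining terms are
nonnegative. The shift by `ε` removes the singularity at `0`. -/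
theorem isSubharmonicC2_of_two_le {q ε : ℝ} (hq : 1 ≤ q) (hε : 0 < ε) :
    IsSubharmonicC2
      (fun z => 2 * q ^ 2 * (z.re ^ 2 * (regSq ε z) ^ (q - 1)) - (regSq ε z) ^ q)
      (fun z h => 2 * q ^ 2 * (2 * z.re * h.re * (regSq ε z) ^ (q - 1) +
        z.re ^ 2 * ((2 * (z.re * h.re + z.im * h.im)) * (q - 1) * (regSq ε z) ^ (q - 1 - 1))) -
        (2 * (z.re * h.re + z.im * h.im)) * q * (regSq ε z) ^ (q - 1))
      (fun z h k => 2 * q ^ 2 * (2 * k.re * h.re * (regSq ε z) ^ (q - 1) +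
        2 * z.re * h.re * ((2 * (z.re * k.re + z.im * k.im)) * (q - 1) *
          (regSq ε z) ^ (q - 1 - 1)) +
        2 * z.re * k.re * ((2 * (z.re * h.re + z.im * h.im)) * (q - 1) *
          (regSq ε z) ^ (q - 1 - 1)) +
        z.re ^ 2 * ((2 * (k.re * h.re + k.im * h.im)) * (q - 1) * (regSq ε z) ^ (q - 1 - 1) +
          (2 * (z.re * h.re + z.im * h.im)) * (q - 1) * ((2 * (z.re * k.re + z.im * k.im)) *
            (q - 1 - 1) * (regSq ε z) ^ (q - 1 - 1 - 1)))) -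
        ((2 * (k.re * h.re + k.im * h.im)) * q * (regSq ε z) ^ (q - 1) +
          (2 * (z.re * h.re + z.im * h.im)) * q * ((2 * (z.re * k.re + z.im * k.im)) * (q - 1) *
            (regSq ε z) ^ (q - 1 - 1)))) := by
  have hpow : ∀ s : ℝ, Continuous fun z : ℂ => (regSq ε z) ^ s := fun s =>
    Continuous.rpow_const (by unfold regSq; fun_prop) fun z => Or.inl (regSq_pos hε z).ne'
  have hd : ∀ {c : ℝ → ℂ} {c' : ℂ} {t : ℝ} (s : ℝ), HasDerivAt c c' t →
      HasDerivAt (fun t => (regSq ε (c t)) ^ s)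
        ((2 * ((c t).re * c'.re + (c t).im * c'.im)) * s * (regSq ε (c t)) ^ (s - 1)) t := by
    intro c c' t s h
    refine HasDerivAt.rpow_const (f := fun t => regSq ε (c t)) ?_ (Or.inl (regSq_pos hε _).ne')
    refine ((((hasDerivAt_re_comp h).fun_pow 2).fun_add
      ((hasDerivAt_im_comp h).fun_pow 2)).add_const ε).congr_deriv ?_
    push_cast
    ring
  constructor
  · have := hpow (q - 1)
    have := hpow q
    fun_prop
  · have h1 := (hpow (q - 1)).comp (continuous_fst (X := ℂ) (Y := ℂ))
    have h2 := (hpow (q - 1 - 1)).comp (continuous_fst (X := ℂ) (Y := ℂ))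
    simp only [Function.comp_def] at h1 h2
    fun_prop
  · have h1 := (hpow (q - 1)).comp (continuous_fst (X := ℂ) (Y := ℂ × ℂ))
    have h2 := (hpow (q - 1 - 1)).comp (continuous_fst (X := ℂ) (Y := ℂ × ℂ))
    have h3 := (hpow (q - 1 - 1 - 1)).comp (continuous_fst (X := ℂ) (Y := ℂ × ℂ))
    simp only [Function.comp_def] at h1 h2 h3
    fun_prop
  · intro z h
    simp only [Complex.neg_re, Complex.neg_im]
    ring
  · intro c c' t h
    refine (((((hasDerivAt_re_comp h).fun_pow 2).fun_mul (hd (q - 1) h)).const_mul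
      (2 * q ^ 2)).fun_sub (hd q h)).congr_deriv ?_
    push_cast
    ring
  · intro c d c' d' t hc hd'
    have hρ := (((hasDerivAt_re_comp hc).fun_mul (hasDerivAt_re_comp hd')).fun_add
      ((hasDerivAt_im_comp hc).fun_mul (hasDerivAt_im_comp hd'))).const_mul 2
    have hx := ((hasDerivAt_re_comp hc).const_mul 2).fun_mul (hasDerivAt_re_comp hd')
    refine (((hx.fun_mul (hd (q - 1) hc)).fun_add (((hasDerivAt_re_comp hc).fun_pow 2).fun_mul
      ((hρ.mul_const (q - 1)).fun_mul (hd (q - 1 - 1) hc)))).const_mul (2 * q ^ 2)).fun_sub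
      ((hρ.mul_const q).fun_mul (hd (q - 1) hc)) |>.congr_deriv ?_
    push_cast
    ring
  · intro z h
    have hr := regSq_pos hε z
    have e1 : (regSq ε z) ^ (q - 1) = (regSq ε z) ^ (q - 1 - 1 - 1) * regSq ε z * regSq ε z := by
      rw [Real.rpow_sub_one hr.ne' (q - 1 - 1), Real.rpow_sub_one hr.ne' (q - 1)]
      field_simp
    have e2 : (regSq ε z) ^ (q - 1 - 1) = (regSq ε z) ^ (q - 1 - 1 - 1) * regSq ε z := by
      rw [Real.rpow_sub_one hr.ne' (q - 1 - 1)]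
      field_simp
    have hR : 0 ≤ (regSq ε z) ^ (q - 1 - 1 - 1) := Real.rpow_nonneg hr.le _
    rw [e1, e2]
    generalize (regSq ε z) ^ (q - 1 - 1 - 1) = R at hR
    have hre : (Complex.I * h).re = -h.im := by simp
    have him : (Complex.I * h).im = h.re := by simp
    simp only [hre, him]
    have hrdef : regSq ε z = z.re ^ 2 + z.im ^ 2 + ε := rfl
    have hq1 : 0 ≤ q - 1 := by linarith
    have key : 0 ≤ R * (h.re ^ 2 + h.im ^ 2) * (q - 1) *
        (2 * q ^ 2 * (8 * z.re ^ 2 * regSq ε z +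
          4 * z.re ^ 2 * ((q - 1) * (z.re ^ 2 + z.im ^ 2) + ε)) + 4 * q * regSq ε z * ε) := by
      positivity
    refine key.trans_eq ?_
    rw [hrdef]
    ring

/-- This is the case `1 < p = 2q ≤ 2`. At `ε = 0` the first term has Laplacian `4 q |x|^(2q-2)`,
which dominates `4 q² |z|^(2q-2)` since `q ≤ 1` and the exponent is nonpositive. The constant blows
up as `p → 1`. -/
theorem isSubharmonicC2_of_le_two {q ε : ℝ} (hq : 1 / 2 < q) (hq1 : q ≤ 1) (hε : 0 < ε) :
    IsSubharmonicC2
      (fun z => 2 / (2 * q - 1) * (z.re ^ 2 + ε) ^ q - (regSq ε z) ^ q)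
      (fun z h => 2 / (2 * q - 1) * ((2 * (z.re * h.re)) * q * (z.re ^ 2 + ε) ^ (q - 1)) -
        (2 * (z.re * h.re + z.im * h.im)) * q * (regSq ε z) ^ (q - 1))
      (fun z h k => 2 / (2 * q - 1) * ((2 * (k.re * h.re)) * q * (z.re ^ 2 + ε) ^ (q - 1) +
          (2 * (z.re * h.re)) * q * ((2 * (z.re * k.re)) * (q - 1) *
            (z.re ^ 2 + ε) ^ (q - 1 - 1))) -
        ((2 * (k.re * h.re + k.im * h.im)) * q * (regSq ε z) ^ (q - 1) +
          (2 * (z.re * h.re + z.im * h.im)) * q * ((2 * (z.re * k.re + z.im * k.im)) * (q - 1) *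
            (regSq ε z) ^ (q - 1 - 1)))) := by
  have hwpos : ∀ z : ℂ, 0 < z.re ^ 2 + ε := fun z => by positivity
  have hpow : ∀ s : ℝ, Continuous fun z : ℂ => (regSq ε z) ^ s := fun s =>
    Continuous.rpow_const (by unfold regSq; fun_prop) fun z => Or.inl (regSq_pos hε z).ne'
  have hpow' : ∀ s : ℝ, Continuous fun z : ℂ => (z.re ^ 2 + ε) ^ s := fun s =>
    Continuous.rpow_const (by fun_prop) fun z => Or.inl (hwpos z).ne'
  have hd : ∀ {c : ℝ → ℂ} {c' : ℂ} {t : ℝ} (s : ℝ), HasDerivAt c c' t →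
      HasDerivAt (fun t => (regSq ε (c t)) ^ s)
        ((2 * ((c t).re * c'.re + (c t).im * c'.im)) * s * (regSq ε (c t)) ^ (s - 1)) t := by
    intro c c' t s h
    refine HasDerivAt.rpow_const (f := fun t => regSq ε (c t)) ?_ (Or.inl (regSq_pos hε _).ne')
    refine ((((hasDerivAt_re_comp h).fun_pow 2).fun_add
      ((hasDerivAt_im_comp h).fun_pow 2)).add_const ε).congr_deriv ?_
    push_cast
    ring
  have hdw : ∀ {c : ℝ → ℂ} {c' : ℂ} {t : ℝ} (s : ℝ), HasDerivAt c c' t →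
      HasDerivAt (fun t => ((c t).re ^ 2 + ε) ^ s)
        ((2 * ((c t).re * c'.re)) * s * ((c t).re ^ 2 + ε) ^ (s - 1)) t := by
    intro c c' t s h
    refine HasDerivAt.rpow_const ?_ (Or.inl (hwpos _).ne')
    refine (((hasDerivAt_re_comp h).fun_pow 2).add_const ε).congr_deriv ?_
    push_cast
    ring
  constructor
  · have := hpow' q
    have := hpow q
    fun_prop
  · have h1 := (hpow (q - 1)).comp (continuous_fst (X := ℂ) (Y := ℂ))
    have h2 := (hpow' (q - 1)).comp (continuous_fst (X := ℂ) (Y := ℂ))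
    simp only [Function.comp_def] at h1 h2
    fun_prop
  · have h1 := (hpow (q - 1)).comp (continuous_fst (X := ℂ) (Y := ℂ × ℂ))
    have h2 := (hpow (q - 1 - 1)).comp (continuous_fst (X := ℂ) (Y := ℂ × ℂ))
    have h3 := (hpow' (q - 1)).comp (continuous_fst (X := ℂ) (Y := ℂ × ℂ))
    have h4 := (hpow' (q - 1 - 1)).comp (continuous_fst (X := ℂ) (Y := ℂ × ℂ))
    simp only [Function.comp_def] at h1 h2 h3 h4
    fun_prop
  · intro z h
    simp only [Complex.neg_re, Complex.neg_im]
    ring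
  · intro c c' t h
    exact ((hdw q h).const_mul (2 / (2 * q - 1))).fun_sub (hd q h)
  · intro c d c' d' t hc hd'
    have hx := ((hasDerivAt_re_comp hc).fun_mul (hasDerivAt_re_comp hd')).const_mul 2
    have hρ := (((hasDerivAt_re_comp hc).fun_mul (hasDerivAt_re_comp hd')).fun_add
      ((hasDerivAt_im_comp hc).fun_mul (hasDerivAt_im_comp hd'))).const_mul 2
    refine (((hx.mul_const q).fun_mul (hdw (q - 1) hc)).const_mul (2 / (2 * q - 1))).fun_sub
      ((hρ.mul_const q).fun_mul (hd (q - 1) hc)) |>.congr_deriv ?_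
    ring
  · intro z h
    have hr := regSq_pos hε z
    have hw := hwpos z
    have hrdef : regSq ε z = z.re ^ 2 + z.im ^ 2 + ε := rfl
    have hRW : (regSq ε z) ^ (q - 1) ≤ (z.re ^ 2 + ε) ^ (q - 1) :=
      Real.rpow_le_rpow_of_nonpos hw (by rw [hrdef]; nlinarith [sq_nonneg z.im]) (by linarith)
    have e1 : (regSq ε z) ^ (q - 1) = (regSq ε z) ^ (q - 1 - 1) * regSq ε z := by
      rw [Real.rpow_sub_one hr.ne' (q - 1)]
      field_simp
    have e2 : (z.re ^ 2 + ε) ^ (q - 1) = (z.re ^ 2 + ε) ^ (q - 1 - 1) * (z.re ^ 2 + ε) := by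
      rw [Real.rpow_sub_one hw.ne' (q - 1)]
      field_simp
    have hR : 0 ≤ (regSq ε z) ^ (q - 1 - 1) := Real.rpow_nonneg hr.le _
    have hW : 0 ≤ (z.re ^ 2 + ε) ^ (q - 1 - 1) := Real.rpow_nonneg hw.le _
    rw [e1, e2] at hRW ⊢
    generalize (regSq ε z) ^ (q - 1 - 1) = R at hR hRW
    generalize (z.re ^ 2 + ε) ^ (q - 1 - 1) = W at hW hRW
    have hre : (Complex.I * h).re = -h.im := by simp
    have him : (Complex.I * h).im = h.re := by simp
    simp only [hre, him]
    have h2q : 0 < 2 * q - 1 := by linarith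
    have hq2 : 0 ≤ 1 - q := by linarith
    have key : 0 ≤ (h.re ^ 2 + h.im ^ 2) * (4 * q) * ((W * (z.re ^ 2 + ε) - R * regSq ε z) +
        (W * ((2 * (1 - q)) * ε) / (2 * q - 1) + R * ((1 - q) * (z.re ^ 2 + z.im ^ 2)))) := by
      have : 0 < q := by linarith
      have := sub_nonneg.2 hRW
      positivity
    refine key.trans_eq ?_
    rw [hrdef]
    have hi : (2 * q - 1) * (2 * q - 1)⁻¹ = 1 := mul_inv_cancel₀ h2q.ne'
    linear_combination (-4 * q * (h.re ^ 2 + h.im ^ 2) * W * (z.re ^ 2 + ε)) * hi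

/-! ### The M. Riesz inequality for analytic trigonometric polynomials -/

section Riesz

variable {G : Type*} [CommGroup G] [TopologicalSpace G] [IsTopologicalGroup G]
    [CompactSpace G] [MeasurableSpace G] [BorelSpace G] {ι : Type*}

/-- The trigonometric polynomial `∑ c j χ j`. -/
noncomputable def trigPoly (s : Finset ι) (χ : ι → PontryaginDual G) (c : ι → ℂ) : C(G, ℂ) :=
  ∑ j ∈ s, c j • charFun (χ j)

theorem trigPoly_apply (s : Finset ι) (χ : ι → PontryaginDual G) (c : ι → ℂ) (x : G) :
    trigPoly s χ c x = ∑ j ∈ s, c j * (χ j x : ℂ) := by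
  simp [trigPoly, ContinuousMap.sum_apply]

/-- `χ j` restricts to the character of frequency `μ j` along `β`. -/
def HasFrequencies (β : Multiplicative ℝ →ₜ* G) (χ : ι → PontryaginDual G) (μ : ι → ℝ) : Prop :=
  ∀ j, ∀ t : ℝ, χ j (β (Multiplicative.ofAdd t)) = Circle.exp (-(μ j * t))

variable {β : Multiplicative ℝ →ₜ* G} {χ : ι → PontryaginDual G} {μ : ι → ℝ}

/-- Passing to the limit `ε → 0` in a regularized mean value inequality. -/
theorem integral_nonneg_of_regularized {F : C(G, ℂ)} {H : ℝ → ℂ → ℝ}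
    (hH : Continuous fun q : ℝ × ℂ => H q.1 q.2) (h0 : H 0 0 = 0)
    (h : ∀ ε > 0, H ε 0 ≤ ∫ x, H ε (F x) ∂(haarProb G)) :
    0 ≤ ∫ x, H 0 (F x) ∂(haarProb G) := by
  have h1 : Continuous fun ε : ℝ => H ε 0 := hH.comp (by fun_prop : Continuous fun ε : ℝ => (ε, (0 : ℂ)))
  have h2 : Continuous fun ε : ℝ => ∫ x, H ε (F x) ∂(haarProb G) := by
    have := continuous_parametric_integral_of_continuous (μ := haarProb G)
      (f := fun (ε : ℝ) (x : G) => H ε (F x))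
      (hH.comp (by fun_prop : Continuous fun q : ℝ × G => (q.1, F q.2))) isCompact_univ
    simpa using this
  refine h0.symm.trans_le ?_
  refine le_of_tendsto_of_tendsto ((h1.tendsto 0).mono_left (nhdsWithin_le_nhds (s := Set.Ioi 0)))
    ((h2.tendsto 0).mono_left nhdsWithin_le_nhds) ?_
  filter_upwards [self_mem_nhdsWithin] with ε hε using h ε hε

theorem regSq_zero (z : ℂ) : regSq 0 z = ‖z‖ ^ 2 := by
  rw [regSq, Complex.sq_norm, Complex.normSq_apply]
  ring

theorem continuous_sq_rpow {q : ℝ} (hq : 0 ≤ q) {f : G → ℝ} (hf : Continuous f) :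
    Continuous fun x => (f x ^ 2) ^ q :=
  (hf.pow 2).rpow_const fun _ => Or.inr hq

/-- The inequality `∫ |F|^(2q) ≤ C ∫ |Re F|^(2q)` for analytic trigonometric polynomials. -/
theorem exists_integral_norm_le_integral_re {q : ℝ} (hq : 1 / 2 < q) :
    ∃ C : ℝ, 0 ≤ C ∧ ∀ (s : Finset ι) (χ : ι → PontryaginDual G) (μ : ι → ℝ) (c : ι → ℂ),
      HasFrequencies β χ μ → (∀ j ∈ s, 0 < μ j) →
      ∫ x, (‖trigPoly s χ c x‖ ^ 2) ^ q ∂(haarProb G) ≤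
        C * ∫ x, ((trigPoly s χ c x).re ^ 2) ^ q ∂(haarProb G) := by
  have hq0 : 0 < q := by linarith
  rcases le_total q 1 with hq1 | hq1
  · have h2q : 0 < 2 * q - 1 := by linarith
    refine ⟨2 / (2 * q - 1), by positivity, fun s χ μ c hχ hμ => ?_⟩
    have hN := continuous_sq_rpow hq0.le (map_continuous (trigPoly s χ c)).norm
    have hu : Continuous fun x => ((trigPoly s χ c x).re ^ 2) ^ q := continuous_sq_rpow hq0.le
      (Complex.continuous_re.comp (map_continuous (trigPoly s χ c)))
    have h := integral_nonneg_of_regularized (F := trigPoly s χ c)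
      (H := fun ε z => 2 / (2 * q - 1) * (z.re ^ 2 + ε) ^ q - (regSq ε z) ^ q) ?_ ?_ ?_
    · simp only [regSq_zero, add_zero] at h
      rw [integral_sub (hu.integrable_haarProb.const_mul _) hN.integrable_haarProb,
        integral_const_mul] at h
      exact sub_nonneg.1 h
    · have h1 : Continuous fun a : ℝ => a ^ q := Real.continuous_rpow_const hq0.le
      unfold regSq
      fun_prop
    · simp [regSq, Real.zero_rpow hq0.ne']
    · intro ε hε
      have := (isSubharmonicC2_of_le_two hq hq1 hε).le_integral s hχ hμ c
      simpa only [trigPoly_apply] using this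
  · refine ⟨4 * q ^ 2 * (4 * q ^ 2) ^ (q - 1), by positivity, fun s χ μ c hχ hμ => ?_⟩
    have hN := continuous_sq_rpow hq0.le (map_continuous (trigPoly s χ c)).norm
    have hN' := continuous_sq_rpow (sub_nonneg.2 hq1) (map_continuous (trigPoly s χ c)).norm
    have hu : Continuous fun x => ((trigPoly s χ c x).re ^ 2) ^ q := continuous_sq_rpow hq0.le
      (Complex.continuous_re.comp (map_continuous (trigPoly s χ c)))
    have hv : Continuous fun x => (trigPoly s χ c x).re ^ 2 * (‖trigPoly s χ c x‖ ^ 2) ^ (q - 1) :=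
      ((Complex.continuous_re.comp (map_continuous (trigPoly s χ c))).pow 2).mul hN'
    have h := integral_nonneg_of_regularized (F := trigPoly s χ c)
      (H := fun ε z => 2 * q ^ 2 * (z.re ^ 2 * (regSq ε z) ^ (q - 1)) - (regSq ε z) ^ q) ?_ ?_ ?_
    · simp only [regSq_zero] at h
      rw [integral_sub (hv.integrable_haarProb.const_mul _) hN.integrable_haarProb] at h
      -- If `4 q² x² ≤ |z|²`, the left side is at most `|z|^(2q) / 2`; otherwise `|z|²` is bounded
      -- by `4 q² x²`. The half is then absorbed into the left side of the integral inequality,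
      -- which doubles the constant.
      have hpt : ∀ z : ℂ, 2 * q ^ 2 * (z.re ^ 2 * (‖z‖ ^ 2) ^ (q - 1)) ≤
          1 / 2 * (‖z‖ ^ 2) ^ q + 2 * q ^ 2 * (4 * q ^ 2) ^ (q - 1) * (z.re ^ 2) ^ q := by
        intro z
        have hmul : ∀ a : ℝ, 0 ≤ a → a * a ^ (q - 1) = a ^ q := fun a ha => by
          rcases ha.eq_or_lt with rfl | ha
          · rw [zero_mul, Real.zero_rpow hq0.ne']
          · rw [Real.rpow_sub_one ha.ne']
            field_simp
        have hN0 : 0 ≤ ‖z‖ ^ 2 := by positivity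
        have hu0 : 0 ≤ z.re ^ 2 := by positivity
        generalize ‖z‖ ^ 2 = N at hN0
        generalize z.re ^ 2 = u at hu0
        rcases le_total (4 * q ^ 2 * u) N with hle | hle
        · have h2 := mul_le_mul_of_nonneg_right hle (Real.rpow_nonneg hN0 (q - 1))
          rw [hmul N hN0] at h2
          have h3 : 0 ≤ 2 * q ^ 2 * (4 * q ^ 2) ^ (q - 1) * u ^ q := by positivity
          linarith
        · have h2 : N ^ (q - 1) ≤ (4 * q ^ 2) ^ (q - 1) * u ^ (q - 1) := by
            rw [← Real.mul_rpow (by positivity) hu0]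
            exact Real.rpow_le_rpow hN0 hle (sub_nonneg.2 hq1)
          have h3 : 2 * q ^ 2 * (u * N ^ (q - 1)) ≤
              2 * q ^ 2 * (u * ((4 * q ^ 2) ^ (q - 1) * u ^ (q - 1))) := by gcongr
          have h4 : 0 ≤ N ^ q := Real.rpow_nonneg hN0 q
          rw [← hmul u hu0]
          linarith
      have h5 : ∫ x, 2 * q ^ 2 * ((trigPoly s χ c x).re ^ 2 * (‖trigPoly s χ c x‖ ^ 2) ^ (q - 1))
          ∂(haarProb G) ≤ ∫ x, (1 / 2 * (‖trigPoly s χ c x‖ ^ 2) ^ q +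
            2 * q ^ 2 * (4 * q ^ 2) ^ (q - 1) * ((trigPoly s χ c x).re ^ 2) ^ q) ∂(haarProb G) :=
        integral_mono (hv.integrable_haarProb.const_mul _)
          ((hN.integrable_haarProb.const_mul _).add (hu.integrable_haarProb.const_mul _))
          fun x => hpt _
      rw [integral_add (hN.integrable_haarProb.const_mul _) (hu.integrable_haarProb.const_mul _),
        integral_const_mul (1 / 2), integral_const_mul (2 * q ^ 2 * (4 * q ^ 2) ^ (q - 1))] at h5
      linarith
    · have h1 : Continuous fun a : ℝ => a ^ q := Real.continuous_rpow_const hq0.le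
      have h2 : Continuous fun a : ℝ => a ^ (q - 1) :=
        Real.continuous_rpow_const (sub_nonneg.2 hq1)
      unfold regSq
      fun_prop
    · simp [regSq, Real.zero_rpow hq0.ne']
    · intro ε hε
      have := (isSubharmonicC2_of_two_le hq1 hε).le_integral s hχ hμ c
      simpa only [trigPoly_apply] using this

variable {p : ℝ≥0∞} [Fact (1 ≤ p)]

theorem norm_classLp_mono {f g : C(G, ℂ)} (h : ∀ x, ‖f x‖ ≤ ‖g x‖) :
    ‖classLp p f‖ ≤ ‖classLp p g‖ := by
  refine Lp.norm_le_norm_of_ae_le ?_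
  filter_upwards [ContinuousMap.coeFn_toLp (p := p) (𝕜 := ℂ) (haarProb G) f,
    ContinuousMap.coeFn_toLp (p := p) (𝕜 := ℂ) (haarProb G) g] with x hf hg
  rw [hf, hg]
  exact h x

theorem norm_classLp_rpow (hp : p ≠ ∞) (f : C(G, ℂ)) :
    ‖classLp p f‖ ^ p.toReal = ∫ x, ‖f x‖ ^ p.toReal ∂(haarProb G) := by
  have hp0 : p ≠ 0 := (zero_lt_one.trans_le (Fact.out : 1 ≤ p)).ne'
  have hpp : 0 < p.toReal := ENNReal.toReal_pos hp0 hp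
  have h0 : 0 ≤ ∫ x, ‖classLp p f x‖ ^ p.toReal ∂(haarProb G) :=
    integral_nonneg fun x => by positivity
  rw [Lp.norm_def, (Lp.memLp (classLp p f)).eLpNorm_eq_integral_rpow_norm hp0 hp,
    ENNReal.toReal_ofReal (Real.rpow_nonneg h0 _), Real.rpow_inv_rpow h0 hpp.ne']
  refine integral_congr_ae ?_
  filter_upwards [ContinuousMap.coeFn_toLp (p := p) (𝕜 := ℂ) (haarProb G) f] with x hf
  rw [hf]

/-- M. Riesz' inequality: an analytic trigonometric polynomial is controlled by its real part. -/
theorem exists_norm_le_of_abs_re_le (hp1 : 1 < p) (hp : p ≠ ∞) :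
    ∃ K : ℝ, 0 ≤ K ∧ ∀ (s : Finset ι) (χ : ι → PontryaginDual G) (μ : ι → ℝ) (c : ι → ℂ),
      HasFrequencies β χ μ → (∀ j ∈ s, 0 < μ j) → ∀ g : C(G, ℂ),
      (∀ x, |(trigPoly s χ c x).re| ≤ ‖g x‖) →
      ‖classLp p (trigPoly s χ c)‖ ≤ K * ‖classLp p g‖ := by
  have hP1 : 1 < p.toReal := by
    rw [← ENNReal.toReal_one]
    exact (ENNReal.toReal_lt_toReal ENNReal.one_ne_top hp).2 hp1
  have hP : 0 < p.toReal := one_pos.trans hP1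
  obtain ⟨C, hC0, hC⟩ := exists_integral_norm_le_integral_re (G := G) (ι := ι) (β := β)
    (q := p.toReal / 2) (by linarith)
  refine ⟨C ^ p.toReal⁻¹, by positivity, fun s χ μ c hχ hμ g hg => ?_⟩
  have hpow : ∀ a : ℝ, (a ^ 2) ^ (p.toReal / 2) = |a| ^ p.toReal := fun a => by
    rw [← sq_abs, ← Real.rpow_natCast, ← Real.rpow_mul (abs_nonneg a)]
    congr 1
    push_cast
    ring
  have h := hC s χ μ c hχ hμ
  simp only [hpow, abs_norm] at h
  rw [← Real.rpow_le_rpow_iff (norm_nonneg _) (by positivity) hP,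
    Real.mul_rpow (by positivity) (norm_nonneg _), Real.rpow_inv_rpow hC0 hP.ne',
    norm_classLp_rpow hp, norm_classLp_rpow hp]
  refine h.trans (mul_le_mul_of_nonneg_left ?_ hC0)
  have hc1 : Continuous fun x => |(trigPoly s χ c x).re| ^ p.toReal :=
    (Complex.continuous_re.comp (map_continuous (trigPoly s χ c))).abs.rpow_const
      fun _ => Or.inr hP.le
  have hc2 : Continuous fun x => ‖g x‖ ^ p.toReal :=
    (map_continuous g).norm.rpow_const fun _ => Or.inr hP.le
  exact integral_mono hc1.integrable_haarProb hc2.integrable_haarProb fun x =>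
    Real.rpow_le_rpow (abs_nonneg _) (hg x) hP.le

end Riesz
-- Projection to negative frequencies
section Projection

variable {G : Type*} [CommGroup G] [TopologicalSpace G] [IsTopologicalGroup G]
    [CompactSpace G] [MeasurableSpace G] [BorelSpace G] {ι : Type*}
    {β : Multiplicative ℝ →ₜ* G} {χ : ι → PontryaginDual G} {μ : ι → ℝ}
    {p : ℝ≥0∞} [Fact (1 ≤ p)]

theorem integral_charFun (γ : PontryaginDual G) (hγ : γ ≠ 1) :
    ∫ x, (γ x : ℂ) ∂(haarProb G) = 0 := by
  obtain ⟨g, hg⟩ : ∃ g, γ g ≠ 1 := by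
    by_contra! h
    exact hγ (PontryaginDual.ext h)
  have h := integral_mul_left_eq_self (μ := haarProb G) (fun x => (γ x : ℂ)) g
  simp only [map_mul, Circle.coe_mul] at h
  rw [integral_const_mul] at h
  have hg' : (γ g : ℂ) ≠ 1 := fun h => hg (Circle.ext h)
  have : ((γ g : ℂ) - 1) * ∫ x, (γ x : ℂ) ∂(haarProb G) = 0 := by
    rw [sub_mul, h, one_mul, sub_self]
  exact (mul_eq_zero.1 this).resolve_left (sub_ne_zero.2 hg')

theorem charCoeff_charFun_self (γ : PontryaginDual G) :
    charCoeff p γ (classLp p (charFun γ)) = 1 := by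
  rw [charCoeff_classLp]
  simp [Complex.mul_conj, Circle.normSq_coe]

theorem charCoeff_charFun_of_ne {γ η : PontryaginDual G} (h : γ ≠ η) :
    charCoeff p γ (classLp p (charFun η)) = 0 := by
  rw [charCoeff_classLp, ← integral_charFun (η * γ⁻¹) (fun h' => h (mul_inv_eq_one.1 h').symm)]
  congr 1 with x
  change (η x : ℂ) * conj (γ x : ℂ) = ((η x * (γ x)⁻¹ : Circle) : ℂ)
  rw [Circle.coe_mul, Circle.coe_inv_eq_conj]

theorem HasFrequencies.eq_one (hβ : DenseRange β) (hχ : HasFrequencies β χ μ) {j : ι}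
    (hj : μ j = 0) : χ j = 1 := by
  have key : (χ j : G → Circle) = fun _ => 1 :=
    hβ.equalizer (map_continuous (χ j)) continuous_const <| funext fun t => by
      refine (hχ j t.toAdd).trans ?_
      simp [hj]
  exact PontryaginDual.ext fun a => congrFun key a

theorem HasFrequencies.ne_one (hχ : HasFrequencies β χ μ) {j : ι} (hj : μ j ≠ 0) : χ j ≠ 1 := by
  intro h
  -- At this time the character takes the value `e^(-iπ) = -1`.
  have h3 := hχ j (Real.pi / μ j)
  rw [h, PontryaginDual.one_apply, mul_div_cancel₀ _ hj] at h3
  have h4 := congrArg (fun z : Circle => (z : ℂ)) h3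
  simp only [Circle.coe_exp, Circle.coe_one] at h4
  push_cast at h4
  rw [neg_mul, Complex.exp_neg, Complex.exp_pi_mul_I] at h4
  norm_num at h4

/-- The constant part of a trigonometric polynomial does not increase the norm. -/
theorem norm_sum_constant_le (hβ : DenseRange β) (hχ : HasFrequencies β χ μ) (s : Finset ι)
    (c : ι → ℂ) :
    ‖∑ j ∈ s with μ j = 0, c j‖ ≤ ‖classLp p (trigPoly s χ c)‖ := by
  have h3 : ∑ j ∈ s with μ j = 0, c j = charCoeff p 1 (classLp p (trigPoly s χ c)) := by
    rw [trigPoly, map_sum, map_sum, Finset.sum_filter]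
    refine Finset.sum_congr rfl fun j _ => ?_
    rw [map_smul, map_smul]
    split_ifs with hj
    · rw [hχ.eq_one hβ hj, charCoeff_charFun_self, smul_eq_mul, mul_one]
    · rw [charCoeff_charFun_of_ne (hχ.ne_one hj).symm, smul_zero]
  rw [h3]
  have h4 := norm_integral_continuousMap_mul_le 1 (classLp p (trigPoly s χ c))
  have h5 : ‖(1 : C(G, ℂ))‖ = 1 := norm_one
  rw [h5, one_mul] at h4
  refine le_trans (le_of_eq ?_) h4
  congr 1
  change ∫ x, _ ∂(haarProb G) = _
  simp

theorem conj_charFun_inv (γ : PontryaginDual G) (x : G) :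
    ((γ⁻¹ x : Circle) : ℂ) = conj (γ x : ℂ) :=
  Circle.coe_inv_eq_conj _

/-- The projection of trigonometric polynomials to negative frequencies is bounded in `L_p`. -/
theorem exists_norm_negative_part_le (hβ : DenseRange β) (hp1 : 1 < p) (hp : p ≠ ∞) :
    ∃ K : ℝ, 0 ≤ K ∧ ∀ (s : Finset ι) (χ : ι → PontryaginDual G) (μ : ι → ℝ) (c : ι → ℂ),
      HasFrequencies β χ μ →
      ‖classLp p (trigPoly (s.filter fun j => μ j < 0) χ c)‖ ≤
        K * ‖classLp p (trigPoly s χ c)‖ := by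
  obtain ⟨K, hK0, hK⟩ := exists_norm_le_of_abs_re_le (ι := ι) (β := β) hp1 hp
  refine ⟨2 * (2 * K), by positivity, fun s χ μ c hχ => ?_⟩
  let s' := s.filter fun j => μ j ≠ 0
  -- With `A`, `B` the positive and negative parts, conjugating `B` makes all frequencies positive.
  -- The coefficients `d₁`, `d₂` give `A + conj B` and `-I (A - conj B)`, whose real parts are the
  -- real and imaginary parts of `A + B`.
  let χ' : ι → PontryaginDual G := fun j => if 0 < μ j then χ j else (χ j)⁻¹
  let d₁ : ι → ℂ := fun j => if 0 < μ j then c j else conj (c j)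
  let d₂ : ι → ℂ := fun j => if 0 < μ j then -Complex.I * c j else Complex.I * conj (c j)
  have hχ' : HasFrequencies β χ' fun j => |μ j| := by
    intro j t
    by_cases hj : 0 < μ j
    · simp only [χ', if_pos hj, abs_of_pos hj, hχ j t]
    · simp only [χ', if_neg hj, abs_of_nonpos (not_lt.1 hj)]
      change (χ j (β (Multiplicative.ofAdd t)))⁻¹ = _
      rw [hχ j t, ← Circle.exp_neg]
      congr 1
      ring
  have hμ' : ∀ j ∈ s', 0 < |μ j| := fun j hj => abs_pos.2 (Finset.mem_filter.1 hj).2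
  let A : C(G, ℂ) := trigPoly (s.filter fun j => 0 < μ j) χ c
  let B : C(G, ℂ) := trigPoly (s.filter fun j => μ j < 0) χ c
  let c₀ : ℂ := ∑ j ∈ s with μ j = 0, c j
  let R : C(G, ℂ) := trigPoly s' χ c
  have hsplit : ∀ f : ι → ℂ, ∑ j ∈ s', f j =
      (∑ j ∈ s with 0 < μ j, f j) + ∑ j ∈ s with μ j < 0, f j := by
    intro f
    simp only [s', Finset.sum_filter]
    rw [← Finset.sum_add_distrib]
    refine Finset.sum_congr rfl fun j _ => ?_
    rcases lt_trichotomy (μ j) 0 with h | h | h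
    · simp [h, h.ne, h.not_gt]
    · simp [h]
    · simp [h, h.ne', h.not_gt]
  have hR : ∀ x, R x = A x + B x := fun x => by
    simp only [R, A, B, trigPoly_apply, hsplit]
  have h1 : ∀ x, trigPoly s' χ' d₁ x = A x + conj (B x) := by
    intro x
    simp only [A, B, trigPoly_apply, hsplit, map_sum, map_mul]
    congr 1
    · refine Finset.sum_congr rfl fun j hj => ?_
      have hj := (Finset.mem_filter.1 hj).2
      simp only [d₁, χ', if_pos hj]
    · refine Finset.sum_congr rfl fun j hj => ?_
      have hj := (Finset.mem_filter.1 hj).2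
      simp only [d₁, χ', if_neg hj.not_gt, conj_charFun_inv]
  have h2 : ∀ x, trigPoly s' χ' d₂ x = -Complex.I * A x + Complex.I * conj (B x) := by
    intro x
    simp only [A, B, trigPoly_apply, hsplit, map_sum, map_mul, Finset.mul_sum]
    congr 1
    · refine Finset.sum_congr rfl fun j hj => ?_
      have hj := (Finset.mem_filter.1 hj).2
      simp only [d₂, χ', if_pos hj]
      ring
    · refine Finset.sum_congr rfl fun j hj => ?_
      have hj := (Finset.mem_filter.1 hj).2
      simp only [d₂, χ', if_neg hj.not_gt, conj_charFun_inv]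
      ring
  have e1 := hK s' χ' _ d₁ hχ' hμ' R fun x => by
    rw [h1, hR]
    refine le_trans (le_of_eq ?_) (Complex.abs_re_le_norm _)
    simp
  have e2 := hK s' χ' _ d₂ hχ' hμ' R fun x => by
    rw [h2, hR]
    refine le_trans (le_of_eq ?_) (Complex.abs_im_le_norm _)
    simp
  -- If `F₁`, `F₂` are the two analytic polynomials, then `conj B = (F₁ - I F₂) / 2`.
  have e3 : ‖classLp p B‖ ≤ ‖classLp p (trigPoly s' χ' d₁)‖ + ‖classLp p (trigPoly s' χ' d₂)‖ := by
    have h3 : ‖classLp p B‖ ≤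
        ‖classLp p ((1 / 2 : ℂ) • (trigPoly s' χ' d₁ - Complex.I • trigPoly s' χ' d₂))‖ := by
      refine norm_classLp_mono fun x => ?_
      rw [← RCLike.norm_conj]
      refine le_of_eq (congrArg norm ?_)
      simp only [ContinuousMap.smul_apply, ContinuousMap.sub_apply, smul_eq_mul, h1, h2]
      linear_combination (1 / 2 * conj (B x) - 1 / 2 * A x) * Complex.I_sq
    refine h3.trans ?_
    rw [map_smul, map_sub, map_smul, norm_smul]
    have h4 := norm_sub_le (classLp p (trigPoly s' χ' d₁)) (Complex.I • classLp p (trigPoly s' χ' d₂))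
    rw [norm_smul, Complex.norm_I, one_mul] at h4
    have h5 : ‖(1 / 2 : ℂ)‖ = 1 / 2 := by norm_num
    rw [h5]
    have h6 := norm_nonneg (classLp p (trigPoly s' χ' d₁))
    have h7 := norm_nonneg (classLp p (trigPoly s' χ' d₂))
    linarith
  -- `R` is the polynomial minus its mean, and the mean is bounded by the norm.
  have e4 : ‖classLp p R‖ ≤ 2 * ‖classLp p (trigPoly s χ c)‖ := by
    have h3 : R = trigPoly s χ c - trigPoly (s.filter fun j => μ j = 0) χ c := by
      simp only [R, s', trigPoly]
      rw [eq_sub_iff_add_eq, add_comm, Finset.sum_filter_add_sum_filter_not]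
    have h4 : ‖classLp p (trigPoly (s.filter fun j => μ j = 0) χ c)‖ ≤
        ‖∑ j ∈ s with μ j = 0, c j‖ := by
      have hs0 : trigPoly (s.filter fun j => μ j = 0) χ c =
          ContinuousMap.const G (∑ j ∈ s with μ j = 0, c j) := by
        ext x
        rw [trigPoly_apply, ContinuousMap.const_apply]
        refine Finset.sum_congr rfl fun j hj => ?_
        have hj := (Finset.mem_filter.1 hj).2
        rw [hχ.eq_one hβ hj, PontryaginDual.one_apply, Circle.coe_one, mul_one]
      rw [hs0]
      refine (norm_classLp_le _).trans ((ContinuousMap.norm_le _ (norm_nonneg _)).2 fun x => le_rfl)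
    rw [h3, map_sub]
    refine (norm_sub_le _ _).trans ?_
    have h5 := norm_sum_constant_le (p := p) hβ hχ s c
    linarith
  calc ‖classLp p B‖ ≤ K * ‖classLp p R‖ + K * ‖classLp p R‖ := e3.trans (add_le_add e1 e2)
    _ = 2 * K * ‖classLp p R‖ := by ring
    _ ≤ 2 * K * (2 * ‖classLp p (trigPoly s χ c)‖) := by gcongr
    _ = _ := by ring

end Projection
-- Partial sums in the Hardy space of the group
section PartialSums

variable {G : Type*} [CommGroup G] [TopologicalSpace G] [IsTopologicalGroup G]
    [CompactSpace G] [MeasurableSpace G] [BorelSpace G]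
    {p : ℝ≥0∞} [Fact (1 ≤ p)] {lam : ℕ → ℝ} {β : Multiplicative ℝ →ₜ* G}
    (hβ : IsLambdaDirichletGroup lam β)

theorem IsLambdaDirichletGroup.hasFrequencies_mul_inv (N : ℕ) :
    HasFrequencies β (fun n => hβ.char n * (hβ.char N)⁻¹) fun n => lam n - lam N := by
  intro n t
  change hβ.char n _ * (hβ.char N _)⁻¹ = _
  rw [hβ.char_spec, hβ.char_spec, ← Circle.exp_neg, ← Circle.exp_add]
  congr 1
  ring

theorem IsLambdaDirichletGroup.char_injective (hlam : StrictMono lam) :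
    Function.Injective hβ.char := by
  intro n m h
  by_contra hnm
  exact (hβ.hasFrequencies_mul_inv m).ne_one (sub_ne_zero.2 fun h => hnm (hlam.injective h))
    (mul_inv_eq_one.2 h)

variable (p) in
/-- The partial sum operator `f ↦ ∑_{n < N} f̂(h_n) h_n` on `L_p(G)`. -/
noncomputable def partialSum (N : ℕ) : Lp ℂ p (haarProb G) →L[ℂ] Lp ℂ p (haarProb G) :=
  ∑ n ∈ Finset.range N, ContinuousLinearMap.smulRight
    (⟨charCoeff p (hβ.char n), continuous_charCoeff _⟩ : Lp ℂ p (haarProb G) →L[ℂ] ℂ)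
    (classLp p (charFun (hβ.char n)))

theorem partialSum_apply (N : ℕ) (f : Lp ℂ p (haarProb G)) :
    partialSum p hβ N f =
      ∑ n ∈ Finset.range N, charCoeff p (hβ.char n) f • classLp p (charFun (hβ.char n)) := by
  rw [partialSum, sum_apply]
  rfl

theorem charCoeff_trigPoly (hlam : StrictMono lam) (s : Finset ℕ) (c : ℕ → ℂ) (n : ℕ) :
    charCoeff p (hβ.char n) (classLp p (trigPoly s hβ.char c)) = if n ∈ s then c n else 0 := by
  rw [trigPoly, map_sum, map_sum]
  simp only [map_smul, smul_eq_mul]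
  split_ifs with hn
  · rw [Finset.sum_eq_single_of_mem n hn, charCoeff_charFun_self, mul_one]
    intro m _ hm
    rw [charCoeff_charFun_of_ne ((hβ.char_injective hlam).ne hm.symm), mul_zero]
  · refine Finset.sum_eq_zero fun m hm => ?_
    rw [charCoeff_charFun_of_ne, mul_zero]
    exact (hβ.char_injective hlam).ne fun h => hn (h ▸ hm)

theorem partialSum_trigPoly (hlam : StrictMono lam) (N : ℕ) (s : Finset ℕ) (c : ℕ → ℂ) :
    partialSum p hβ N (classLp p (trigPoly s hβ.char c)) =
      classLp p (trigPoly (s.filter (· < N)) hβ.char c) := by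
  rw [partialSum_apply]
  simp only [charCoeff_trigPoly hβ hlam, ite_smul, zero_smul]
  rw [← Finset.sum_filter, trigPoly, map_sum]
  simp only [map_smul]
  refine Finset.sum_congr ?_ fun _ _ => rfl
  ext n
  simp [and_comm]

/-- Modulation by a unimodular character preserves all norms, and the projection constant does not
depend on the characters or frequencies, so one `K` serves every `N`. -/
theorem exists_norm_partialSum_trigPoly_le (hlam : StrictMono lam) (hp1 : 1 < p) (hp : p ≠ ∞) :
    ∃ K : ℝ, 0 ≤ K ∧ ∀ (N : ℕ) (s : Finset ℕ) (c : ℕ → ℂ),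
      ‖partialSum p hβ N (classLp p (trigPoly s hβ.char c))‖ ≤
        K * ‖classLp p (trigPoly s hβ.char c)‖ := by
  obtain ⟨K, hK0, hK⟩ := exists_norm_negative_part_le (ι := ℕ) hβ.denseRange hp1 hp
  refine ⟨K, hK0, fun N s c => ?_⟩
  have hmul : ∀ (s : Finset ℕ) (x : G),
      trigPoly s (fun n => hβ.char n * (hβ.char N)⁻¹) c x =
        trigPoly s hβ.char c x * conj (hβ.char N x : ℂ) := by
    intro s x
    rw [trigPoly_apply, trigPoly_apply, Finset.sum_mul]
    refine Finset.sum_congr rfl fun n _ => ?_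
    change c n * ((hβ.char n x * (hβ.char N x)⁻¹ : Circle) : ℂ) = _
    rw [Circle.coe_mul, Circle.coe_inv_eq_conj, mul_assoc]
  have hnorm : ∀ (s : Finset ℕ) (x : G),
      ‖trigPoly s (fun n => hβ.char n * (hβ.char N)⁻¹) c x‖ = ‖trigPoly s hβ.char c x‖ := by
    intro s x
    rw [hmul, norm_mul, RCLike.norm_conj, Circle.norm_coe, mul_one]
  have hfilter : (s.filter fun n => lam n - lam N < 0) = s.filter (· < N) := by
    ext n
    simp [sub_neg, hlam.lt_iff_lt]
  have h := hK s _ _ c (hβ.hasFrequencies_mul_inv N)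
  rw [hfilter] at h
  rw [partialSum_trigPoly hβ hlam]
  refine (norm_classLp_mono fun x => (hnorm _ x).ge).trans (h.trans ?_)
  exact mul_le_mul_of_nonneg_left (norm_classLp_mono fun x => (hnorm _ x).le) hK0

theorem exists_eq_trigPoly_of_mem_span (f : Lp ℂ p (haarProb G))
    (hf : f ∈ Submodule.span ℂ (Set.range fun n => classLp p (charFun (hβ.char n)))) :
    ∃ (s : Finset ℕ) (c : ℕ → ℂ), f = classLp p (trigPoly s hβ.char c) := by
  obtain ⟨c, rfl⟩ := (Finsupp.mem_span_range_iff_exists_finsupp).1 hf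
  refine ⟨c.support, c, ?_⟩
  simp [trigPoly, Finsupp.sum]

theorem charFun_mem_hardyGroup (n : ℕ) : classLp p (charFun (hβ.char n)) ∈ hardyGroup p hβ := by
  intro γ hγ
  refine ⟨n, ?_⟩
  by_contra h
  exact hγ (charCoeff_charFun_of_ne h)

variable [T2Space G]

theorem mem_closure_span_of_mem_hardyGroup (hp : p ≠ ∞) {f : Lp ℂ p (haarProb G)}
    (hf : f ∈ hardyGroup p hβ) :
    f ∈ closure (Submodule.span ℂ (Set.range fun n => classLp p (charFun (hβ.char n))) :
      Set (Lp ℂ p (haarProb G))) := by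
  refine closure_mono (SetLike.coe_subset_coe.2 (Submodule.span_mono ?_))
    (mem_closure_span_spectrum hp f)
  rintro _ ⟨γ, hγ, rfl⟩
  obtain ⟨n, rfl⟩ := hf γ hγ
  exact ⟨n, rfl⟩

/-- Uniform bounds pass from the dense polynomials to the whole Hardy space, and on each polynomial
the partial sums are eventually constant. -/
theorem tendsto_partialSum (hlam : StrictMono lam) (hp1 : 1 < p) (hp : p ≠ ∞)
    {f : Lp ℂ p (haarProb G)} (hf : f ∈ hardyGroup p hβ) :
    Tendsto (fun N => partialSum p hβ N f) atTop (𝓝 f) := by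
  obtain ⟨K, hK0, hK⟩ := exists_norm_partialSum_trigPoly_le hβ hlam hp1 hp
  have hbound : ∀ N, ∀ g ∈ hardyGroup p hβ, ‖partialSum p hβ N g‖ ≤ K * ‖g‖ := by
    intro N g hg
    refine closure_minimal ?_ (isClosed_le (partialSum p hβ N).continuous.norm
      (continuous_const.mul continuous_norm)) (mem_closure_span_of_mem_hardyGroup hβ hp hg)
    intro g hg
    obtain ⟨s, c, rfl⟩ := exists_eq_trigPoly_of_mem_span hβ g hg
    exact hK N s c
  refine Metric.tendsto_atTop.2 fun ε hε => ?_
  obtain ⟨g, hg, hfg⟩ := Metric.mem_closure_iff.1 (mem_closure_span_of_mem_hardyGroup hβ hp hf)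
    (ε / (K + 1)) (by positivity)
  have hgH : g ∈ hardyGroup p hβ :=
    Submodule.span_le.2 (Set.range_subset_iff.2 (charFun_mem_hardyGroup hβ)) hg
  obtain ⟨s, c, rfl⟩ := exists_eq_trigPoly_of_mem_span hβ g hg
  -- The sums run over `n < N`, so `N` must exceed the largest index in `s`.
  refine ⟨s.sup id + 1, fun N hN => ?_⟩
  have hfix : partialSum p hβ N (classLp p (trigPoly s hβ.char c)) =
      classLp p (trigPoly s hβ.char c) := by
    rw [partialSum_trigPoly hβ hlam, Finset.filter_true_of_mem]
    intro n hn
    have : n ≤ s.sup id := Finset.le_sup (f := id) hn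
    omega
  set g := classLp p (trigPoly s hβ.char c)
  rw [dist_eq_norm] at hfg ⊢
  have h1 : partialSum p hβ N f - f = partialSum p hβ N (f - g) - (f - g) := by
    rw [map_sub, hfix]
    abel
  rw [h1]
  calc ‖partialSum p hβ N (f - g) - (f - g)‖ ≤ K * ‖f - g‖ + ‖f - g‖ :=
        (norm_sub_le _ _).trans (add_le_add (hbound N _ (sub_mem hf hgH)) le_rfl)
    _ = (K + 1) * ‖f - g‖ := by ring
    _ < (K + 1) * (ε / (K + 1)) := by gcongr
    _ = ε := by field_simp

/-! ### Transfer to Dirichlet series by the Bohr map -/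

namespace HardySpace

theorem bohr_injective (hp : p ≠ ∞) : Function.Injective (bohr p hβ) := by
  refine (injective_iff_map_eq_zero _).2 fun f hf => ?_
  have h0 : ∀ γ, charCoeff p γ (f : Lp ℂ p (haarProb G)) = 0 := by
    intro γ
    by_contra h
    obtain ⟨n, rfl⟩ := f.2 γ h
    refine h ?_
    rw [← toSeries_bohr, hf]
    rfl
  have h := mem_closure_span_spectrum hp (f : Lp ℂ p (haarProb G))
  simp only [h0, ne_eq, not_true_eq_false, Set.ofPred_false, Set.image_empty,
    Submodule.span_empty, Submodule.bot_coe, closure_singleton, Set.mem_singleton_iff] at h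
  exact Subtype.ext h

/-- Since the Bohr map is injective, the infimum defining the norm runs over a single function. -/
theorem norm_bohr (hp : p ≠ ∞) (f : hardyGroup p hβ) : ‖bohr p hβ f‖ = ‖f‖ := by
  have h : {g : hardyGroup p hβ | bohr p hβ g = bohr p hβ f} = {f} := by
    ext g
    exact (bohr_injective hβ hp).eq_iff
  rw [norm_eq_sInf, h, Set.image_singleton, csInf_singleton]

theorem bohr_surjective : Function.Surjective (bohr p hβ) :=
  (bohrMap p hβ).surjective_rangeRestrict

variable (p) in
/-- The Dirichlet coefficients as continuous linear functionals on `ℋ_p(λ)`. -/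
noncomputable def coeffCLM (hp : p ≠ ∞) (n : ℕ) : HardySpace p hβ →L[ℂ] ℂ :=
  LinearMap.mkContinuous
    { toFun := fun D => D.toSeries n
      map_add' := fun _ _ => rfl
      map_smul' := fun _ _ => rfl } 1 fun D => by
    obtain ⟨f, rfl⟩ := bohr_surjective hβ D
    change ‖charCoeff p (hβ.char n) (f : Lp ℂ p (haarProb G))‖ ≤ _
    rw [norm_bohr hβ hp, one_mul]
    have h : ‖star (charFun (hβ.char n))‖ ≤ 1 := by
      refine (ContinuousMap.norm_le _ zero_le_one).2 fun x => ?_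
      simp [Circle.norm_coe]
    have h2 := norm_integral_continuousMap_mul_le (star (charFun (hβ.char n)))
      (f : Lp ℂ p (haarProb G))
    refine le_trans (le_of_eq ?_) (h2.trans (mul_le_of_le_one_left (norm_nonneg _) h))
    congr 1
    refine integral_congr_ae (ae_of_all _ fun x => ?_)
    exact mul_comm _ _

@[simp]
theorem coeffCLM_apply (hp : p ≠ ∞) (n : ℕ) (D : HardySpace p hβ) :
    coeffCLM p hβ hp n D = D.toSeries n := rfl

variable (p) in
/-- The monomial `e^(-λ n s)` as an element of `ℋ_p(λ)`. -/
noncomputable def monomialElem (n : ℕ) : HardySpace p hβ :=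
  bohr p hβ ⟨classLp p (charFun (hβ.char n)), charFun_mem_hardyGroup hβ n⟩

theorem toSeries_monomialElem (hlam : StrictMono lam) (n : ℕ) :
    (monomialElem p hβ n).toSeries = monomial lam n := by
  ext m
  rw [monomialElem, toSeries_bohr, monomial, Pi.single_apply]
  split_ifs with h
  · rw [h, charCoeff_charFun_self]
  · exact charCoeff_charFun_of_ne ((hβ.char_injective hlam).ne h)

theorem hasSum_coeff_smul_monomialElem (hlam : StrictMono lam) (hp1 : 1 < p) (hp : p ≠ ∞)
    (D : HardySpace p hβ) :
    HasSum (fun n => D.toSeries n • monomialElem p hβ n) D (SummationFilter.conditional ℕ) := by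
  obtain ⟨f, rfl⟩ := bohr_surjective hβ D
  -- Only convergence of the partial sums in the given order is asserted, not unconditional
  -- summability.
  rw [HasSum, SummationFilter.conditional_filter_eq_map_range, tendsto_map'_iff]
  let e : hardyGroup p hβ →ₗᵢ[ℂ] HardySpace p hβ := ⟨bohr p hβ, norm_bohr hβ hp⟩
  let S : ℕ → hardyGroup p hβ := fun N => ∑ n ∈ Finset.range N,
    toSeries (bohr p hβ f) n •
      (⟨classLp p (charFun (hβ.char n)), charFun_mem_hardyGroup hβ n⟩ : hardyGroup p hβ)
  have hS : Tendsto S atTop (𝓝 f) := by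
    rw [tendsto_subtype_rng]
    refine (tendsto_partialSum hβ hlam hp1 hp f.2).congr fun N => ?_
    simp only [S, partialSum_apply, AddSubmonoidClass.coe_finsetSum]
    rfl
  refine ((e.continuous.tendsto f).comp hS).congr fun N => ?_
  change e (S N) = _
  simp only [S, map_sum, map_smul]
  rfl

variable (p) in
/-- The Schauder basis of monomials of `ℋ_p(λ)`. -/
noncomputable def monomialBasis (hlam : StrictMono lam) (hp1 : 1 < p) (hp : p ≠ ∞) :
    SchauderBasis ℂ (HardySpace p hβ) where
  basis := monomialElem p hβ
  coord := coeffCLM p hβ hp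
  ortho i j := by
    rw [coeffCLM_apply, toSeries_monomialElem hβ hlam, monomial]
    by_cases h : i = j <;> simp [h]
  expansion D := hasSum_coeff_smul_monomialElem hβ hlam hp1 hp D

end HardySpace

end PartialSums

end GeneralDirichlet

theorem mainTheorem3 {G : Type*} [CommGroup G] [TopologicalSpace G] [IsTopologicalGroup G]
    [CompactSpace G] [T2Space G] [MeasurableSpace G] [BorelSpace G]
    (p : ℝ≥0∞) [Fact (1 ≤ p)] (hp1 : 1 < p) (hp : p < ∞)
    (lam : ℕ → ℝ) (hlam : IsFrequency lam)
    (β : Multiplicative ℝ →ₜ* G) (hβ : IsLambdaDirichletGroup lam β) :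
    (∀ f : hardyGroup p hβ, ‖HardySpace.bohr p hβ f‖ = ‖f‖) ∧
    ∃ b : SchauderBasis ℂ (HardySpace p hβ),
      (∀ n, (b n).toSeries = monomial lam n) ∧
      (∀ n (D : HardySpace p hβ), b.coord n D = D.toSeries n) ∧
      ∃ C : ℝ, ∀ N, ‖b.proj N‖ ≤ C := by
  exact ⟨HardySpace.norm_bohr hβ hp.ne,
    HardySpace.monomialBasis p hβ hlam.strictMono hp1 hp.ne,
    HardySpace.toSeries_monomialElem hβ hlam.strictMono, fun _ _ => rfl,
    -- Projections of a Schauder basis of a Banach space are uniformly bounded, by Banach–Steinhaus.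
    SchauderBasis.exists_norm_proj_le _⟩
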